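/- **Racks and presentations.** A rack is a set with two binary operations, written $x^{y}$ and $x^{\bar y}$, such that $(x^{y})^{\bar y}=(x^{\bar y})^{y}=x$ and $(x^{y})^{z}=(x^{z})^{(y^{z})}$ for all $x,y,z$. Let $S=\{x_1,\dots,x_g\}$ be finite, $\bar S=\{\bar x_1,\dots,\bar x_g\}$, and let $F(S)$ be the free group on $S$, where $\bar w$ denotes the inverse of $w$ and elements are identified with reduced words in $S\cup\bar S$. The free rack $FR(S)$ is the set of all $a^u$ with $a\in S$, $u\in F(S)$ (and $a^u=b^v$ iff $a=b$ and $u=v$), with $(a^u)^{(b^v)}=a^{u\bar v b v}$ and $(a^u)^{\overline{(b^v)}}=a^{u\bar v\bar b v}$. Let $R$ be a finite set of relations $x_i^{u}=x_j$ with $u\in F(S)$, such that $i=j$ whenever $u$ is the empty word. Let $\mathcal R=\langle S\mid R\rangle$ be the quotient of $FR(S)$ by the smallest congruence containing $(x_i^{u},x_j)$ for all relations in $R$. **Tables.** An enumeration table consists of a number $\omega$ of rows, a partial function $(i,y)\mapsto i^y$ from $\{1,\dots,\omega\}\times(S\cup\bar S)$ to $\{1,\dots,\omega\}$, a map $\tau:\{1,\dots,\omega\}\to\mathcal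 R$, and a map $\rho:\{1,\dots,\omega\}\to\{1,\dots,\omega\}$ with $\rho(i)\le i$. The set of live rows is $\Omega=\{i\mid 1\le i\le\omega,\ \rho(i)=i\}$. For $w=y_1\cdots y_t\in F(S)$ written as a reduced word, $j^w$ is defined and equal to $k$ if successively applying $y_1,\dots,y_t$ to $j$ is always defined and ends in $k$. $\mathrm{Rep}(i)$ is the live row reached from $i$ by iterating $\rho$. **Procedures** (each changes the current table; a `for' loop may take the elements of its finite set in any order). * Define$(i,y)$: increase $\omega$ by $1$; then set $i^y:=\omega$, $\omega^{\bar y}:=i$, $\tau(\omega):=\tau(i)^y$, $\rho(\omega):=\omega$. * Update$(i)$: set $\rho(j):=\mathrm{Rep}(i)$ for every $j\neq \mathrm{Rep}(i)$ in the $\rho$-orbit of $i$. * Merge$(m,n)$: let $\mu=\mathrm{Rep}(m)$, $\nu=\mathrm{Rep}(n)$; if $\mu\ne\nu$, append $\max(\mu,\nu)$ to the queue $Q$ and set $\rho(\max(\mu,\nu)):=\min(\mu,\nu)$. * Coincidence$(m,n)$: start with $Q$ empty and call Merge$(m,n)$. While $Q$ has an untreated element, take the first such element $d$, and for each $x\in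 S\cup\bar S$ such that $d^x$ is defined, say $d^x=e$: undefine $d^x$ and $e^{\bar x}$; let $\delta=\mathrm{Rep}(d)$ and call Update$(d)$; let $\epsilon=\mathrm{Rep}(e)$ and call Update$(e)$; if $\delta^x$ is defined call Merge$(\epsilon,\delta^x)$, else if $\epsilon^{\bar x}$ is defined call Merge$(\delta,\epsilon^{\bar x})$, else set $\delta^x:=\epsilon$ and $\epsilon^{\bar x}:=\delta$. * Scan$(i,w,j)$, for $w=y_1\cdots y_t$ reduced: put $f=1$, $b=t$, $k=i$, $\ell=j$. While $f\le b$: as long as $f\le b$ and $k^{y_f}$ is defined, replace $k$ by $k^{y_f}$ and $f$ by $f+1$; then, as long as $f\le b$ and $\ell^{\bar y_b}$ is defined, replace $\ell$ by $\ell^{\bar y_b}$ and $b$ by $b-1$; then, if $f<b$, call Define$(k,y_f)$; if $f=b$, set $k^{y_f}:=\ell$ and $\ell^{\bar y_f}:=k$ and stop; if $f>b$ and $k\ne\ell$, call Coincidence$(k,\ell)$; if $f>b$ and $k=\ell$, stop. * Enumerate$(S,R,M)$: let $R_2$ be the set of reduced words of $\bar u x_i u\bar x_j$ for the relations $x_i^u=x_j$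 in $R$. Start with the table with $\omega=g$, no entries defined, $\tau(i)=x_i$ and $\rho(i)=i$. For each relation $x_i^u=x_j$ in $R$ call Scan$(\mathrm{Rep}(i),u,\mathrm{Rep}(j))$. Put $i=1$. While $i\le\max\Omega$ and $i\le M$: for each $w\in R_2$ call Scan$(i,w,i)$ as long as $i$ is live; then, if $i$ is live, call Define$(i,y)$ for each $y\in S\cup\bar S$ for which $i^y$ is undefined; then increase $i$ by $1$. If finally $i>\max\Omega$, the process *completes* and returns the table; otherwise it returns `run limit exceeded'. (If $\Omega=\emptyset$, that is, $g=0$, the inequality $i\le\max\Omega$ is false.) **Theorem.** Suppose that Enumerate$(S,R,M)$ completes, and let $\Omega$ and $\tau$ be the set of live rows and the map of the returned table. Then every $j\in\Omega$ can be written as $j=k^w$ with $k\in\Omega\cap\{1,\dots,g\}$ and $w\in F(S)$. The formulas $$i^{j}=i^{\bar w x_k w},\qquad i^{\bar j}=i^{\bar w\bar x_k w}\qquad(i,j\in\Omega,\ j=k^w)$$ give well-defined operations on $\Omega$ (the right-hand sides are defined, lie in $\Omega$, and do not depend on the choice of $k$ and $w$), and $\Omega$ with these operations is a rack. Moreover,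 the restriction $\tau:\Omega\to\mathcal R$ is a rack isomorphism. -/

import Mathlib

open scoped Quandles

namespace RackEnum

/-! ### Free racks and racks given by a presentation

The exponential notation `x ^ y` of right racks is rendered by Mathlib's rack operation as
`x ^ y = y ◃ x` and `x ^ (bar y) = y ◃⁻¹ x`. -/

/-- An element `base ^ exponent` of the free rack on `S`: a generator together with an element of
the free group on `S`. -/
@[ext]
structure FreeRack (S : Type*) where
  base : S
  exponent : FreeGroup S

/-- The operations of the free rack:
`(a ^ u) ^ (b ^ v) = a ^ (u * v⁻¹ * b * v)` and `(a ^ u) ^ (bar (b ^ v)) = a ^ (u * v⁻¹ * b⁻¹ * v)`. -/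
instance (S : Type*) : Rack (FreeRack S) where
  act y x := ⟨x.base, x.exponent * y.exponent⁻¹ * FreeGroup.of y.base * y.exponent⟩
  invAct y x := ⟨x.base, x.exponent * y.exponent⁻¹ * (FreeGroup.of y.base)⁻¹ * y.exponent⟩
  self_distrib := by
    intro x y z
    ext1
    · rfl
    · simp only []
      group
  left_inv := by
    intro y x
    ext1
    · rfl
    · simp only []
      group
  right_inv := by
    intro y x
    ext1
    · rfl
    · simp only []
      group

/-- A (primary) relation `src ^ word = tgt`. Elements of the free group correspond to reduced words. -/
structure Relation (S : Type*) where
  src : S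
  word : FreeGroup S
  tgt : S

/-- The smallest congruence on the free rack (an equivalence relation that respects both rack
operations) containing all the pairs `(src ^ word, tgt)` for the relations in `R`. -/
inductive Cong {S : Type*} (R : Finset (Relation S)) : FreeRack S → FreeRack S → Prop
  | rel (r : Relation S) (hr : r ∈ R) : Cong R ⟨r.src, r.word⟩ ⟨r.tgt, 1⟩
  | refl (x : FreeRack S) : Cong R x x
  | symm {x y : FreeRack S} : Cong R x y → Cong R y x
  | trans {x y z : FreeRack S} : Cong R x y → Cong R y z → Cong R x z
  | act {x x' y y' : FreeRack S} : Cong R x x' → Cong R y y' → Cong R (y ◃ x) (y' ◃ x')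
  | invAct {x x' y y' : FreeRack S} : Cong R x x' → Cong R y y' → Cong R (y ◃⁻¹ x) (y' ◃⁻¹ x')

def congSetoid {S : Type*} (R : Finset (Relation S)) : Setoid (FreeRack S) where
  r := Cong R
  iseqv := ⟨Cong.refl, Cong.symm, Cong.trans⟩

/-- The rack `⟨S | R⟩`. -/
def PresentedRack {S : Type*} (R : Finset (Relation S)) : Type _ := Quotient (congSetoid R)

instance {S : Type*} (R : Finset (Relation S)) : Rack (PresentedRack R) where
  act := Quotient.map₂ (fun y x => y ◃ x) (fun _ _ hy _ _ hx => Cong.act hx hy)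
  invAct := Quotient.map₂ (fun y x => y ◃⁻¹ x) (fun _ _ hy _ _ hx => Cong.invAct hx hy)
  self_distrib := by
    rintro ⟨x⟩ ⟨y⟩ ⟨z⟩
    exact congrArg (Quotient.mk (congSetoid R)) Shelf.self_distrib
  left_inv := by
    rintro ⟨y⟩ ⟨x⟩
    exact congrArg (Quotient.mk (congSetoid R)) (Rack.left_inv y x)
  right_inv := by
    rintro ⟨y⟩ ⟨x⟩
    exact congrArg (Quotient.mk (congSetoid R)) (Rack.right_inv y x)

/-- The class of the generator `a` in `⟨S | R⟩`. -/
def gen {S : Type*} (R : Finset (Relation S)) (a : S) : PresentedRack R :=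
  Quotient.mk (congSetoid R) ⟨a, 1⟩

/-! ### Letters and enumeration tables -/

/-- The set `S ∪ bar S` for `S = {x_1, …, x_g}`, encoded as in Mathlib's free group:
`(a, true)` is the generator `a` and `(a, false)` is its inverse `bar a`. -/
abbrev Letter (g : ℕ) : Type := Fin g × Bool

/-- The inverse letter. -/
def bar {g : ℕ} (y : Letter g) : Letter g := (y.1, !y.2)

/-- `x ^ y` in the presented rack, for a letter `y`. -/
def letterAct {g : ℕ} {R : Finset (Relation (Fin g))} (x : PresentedRack R) (y : Letter g) :
    PresentedRack R :=
  if y.2 then gen R y.1 ◃ x else gen R y.1 ◃⁻¹ x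

/-- An enumeration table for `⟨S | R⟩`, with rows numbered `1, …, ω`. The entry `i ^ y` is `A i y`
(`none` if it is undefined). Only the values at rows `1, …, ω` are meaningful; the rows that do not
exist have no value of `τ`. -/
structure Table {g : ℕ} (R : Finset (Relation (Fin g))) where
  ω : ℕ
  A : ℕ → Letter g → Option ℕ
  τ : ℕ → Option (PresentedRack R)
  ρ : ℕ → ℕ

/-- The row that initially represents the generator `k`: generators are indexed from `0`, rows
from `1`. -/
def genRow {g : ℕ} (k : Fin g) : ℕ := k.val + 1

/-- The entries `A` with the entry in row `i` and column `y` replaced by `v`. -/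
def setEntry {g : ℕ} (A : ℕ → Letter g → Option ℕ) (i : ℕ) (y : Letter g) (v : Option ℕ) :
    ℕ → Letter g → Option ℕ :=
  fun i' y' => if i' = i ∧ y' = y then v else A i' y'

/-- The value of `j ^ w` for a word `w = y_1 y_2 … y_t`, if it is defined. -/
def evalWord {g : ℕ} (A : ℕ → Letter g → Option ℕ) : ℕ → List (Letter g) → Option ℕ
  | j, [] => some j
  | j, y :: w => (A j y).bind fun k => evalWord A k w

/-- Least representative of `j`. -/
def rep (ρ : ℕ → ℕ) (j : ℕ) : ℕ :=
  if ρ j < j then rep ρ (ρ j) else j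
termination_by j

/-- The loop of `update`: while `ρ n < n`, set `ρ n := ε` and move on to the old value of `ρ n`. -/
def updateLoop (ε : ℕ) (ρ : ℕ → ℕ) (n : ℕ) : ℕ → ℕ :=
  if ρ n < n then updateLoop ε (Function.update ρ n ε) (ρ n) else ρ
termination_by n

/-- Set `ρ j` to the least representative of `i` for all `j` in the orbit of `i`. -/
def update (ρ : ℕ → ℕ) (i : ℕ) : ℕ → ℕ := updateLoop (rep ρ i) ρ i

namespace Table

variable {g : ℕ} {R : Finset (Relation (Fin g))}

/-- The live rows of a table. -/
def Ω (T : Table R) : Set ℕ := {i | 1 ≤ i ∧ i ≤ T.ω ∧ T.ρ i = i}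

/-- The value of `j ^ w` for `w` in the free group, if it is defined. -/
def pow (T : Table R) (j : ℕ) (w : FreeGroup (Fin g)) : Option ℕ := evalWord T.A j w.toWord

/-- The initial table: one row for each generator, no entries. -/
def init (R : Finset (Relation (Fin g))) : Table R where
  ω := g
  A := fun _ _ => none
  τ := fun i => if h : 1 ≤ i ∧ i ≤ g then some (gen R ⟨i - 1, by omega⟩) else none
  ρ := fun i => i

/-- Procedure Define: add a new row `ω + 1` to serve as `i ^ y`. -/
def define (T : Table R) (i : ℕ) (y : Letter g) : Table R where
  ω := T.ω + 1
  A := setEntry (setEntry T.A i y (some (T.ω + 1))) (T.ω + 1) (bar y) (some i)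
  τ := Function.update T.τ (T.ω + 1) ((T.τ i).map fun x => letterAct x y)
  ρ := Function.update T.ρ (T.ω + 1) (T.ω + 1)

/-- Add the inverse pair of entries `i ^ y = j` and `j ^ (bar y) = i` (procedure Deduction). -/
def deduction (T : Table R) (i : ℕ) (y : Letter g) (j : ℕ) : Table R :=
  { T with A := setEntry (setEntry T.A i y (some j)) j (bar y) (some i) }

/-- Remove the entries `i ^ y` and `j ^ (bar y)`. -/
def undefine (T : Table R) (i : ℕ) (y : Letter g) (j : ℕ) : Table R :=
  { T with A := setEntry (setEntry T.A i y none) j (bar y) none }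

end Table

/-! ### Loops

A loop is described by the relation between its initial and its final states. -/

/-- `while c do body`, started in the first state, terminates in the second one. -/
inductive While {σ : Type*} (c : σ → Prop) (body : σ → σ → Prop) : σ → σ → Prop
  | done {s : σ} : ¬ c s → While c body s s
  | step {s s' s'' : σ} : c s → body s s' → While c body s' s'' → While c body s s''

/-- `for x in l do body x`, for a list `l`. -/
inductive ForList {α σ : Type*} (body : α → σ → σ → Prop) : List α → σ → σ → Prop
  | nil {s : σ} : ForList body [] s s
  | cons {x : α} {l : List α} {s s' s'' : σ} :
      body x s s' → ForList body l s' s'' → ForList body (x :: l) s s''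

/-- `for x in X do body x`, for a finite set `X`, whose elements are taken in any order. -/
def ForEach {α σ : Type*} (X : Finset α) (body : α → σ → σ → Prop) (s s' : σ) : Prop :=
  ∃ l : List α, l.Nodup ∧ (∀ x, x ∈ l ↔ x ∈ X) ∧ ForList body l s s'

/-! ### The procedures -/

section Procedures

variable {g : ℕ} {R : Finset (Relation (Fin g))}

/-- Procedure Merge: queue the coincidence `m ≡ n`. The second component of the state is the
queue. -/
def merge (s : Table R × List ℕ) (m n : ℕ) : Table R × List ℕ :=
  let μ := rep s.1.ρ m
  let ν := rep s.1.ρ n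
  if μ = ν then s
  else ({ s.1 with ρ := Function.update s.1.ρ (max μ ν) (min μ ν) }, s.2 ++ [max μ ν])

/-- The body of the inner loop of Coincidence: treat the entry in the dead row `d` and the
column `x`. -/
def coincidenceStep (d : ℕ) (x : Letter g) (s : Table R × List ℕ) : Table R × List ℕ :=
  match s.1.A d x with
  | none => s
  | some e =>
    let T₁ := s.1.undefine d x e
    let δ := rep T₁.ρ d
    let T₂ : Table R := { T₁ with ρ := update T₁.ρ d }
    let ε := rep T₂.ρ e
    let T₃ : Table R := { T₂ with ρ := update T₂.ρ e }
    match T₃.A δ x with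
    | some f => merge (T₃, s.2) ε f
    | none =>
      match T₃.A ε (bar x) with
      | some f => merge (T₃, s.2) δ f
      | none => (T₃.deduction δ x ε, s.2)

/-- Procedure Coincidence, changing the table `T` into `T'`. The list in the state is the part of
the queue that has not yet been treated. -/
def Coincidence (T : Table R) (m n : ℕ) (T' : Table R) : Prop :=
  While (fun s => s.2 ≠ [])
    (fun s s' => ∃ d Q, s.2 = d :: Q ∧
      ForEach Finset.univ (fun x t t' => t' = coincidenceStep d x t) (s.1, Q) s')
    (merge (T, []) m n) (T', [])

/-- Scanning forward from `k` along the word `v` as far as possible: returns the last row that is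
reached and the part of `v` that remains. -/
def scanForward (A : ℕ → Letter g → Option ℕ) : ℕ → List (Letter g) → ℕ × List (Letter g)
  | k, [] => (k, [])
  | k, y :: v =>
    match A k y with
    | some k' => scanForward A k' v
    | none => (k, y :: v)

/-- Scanning backward from `l` along `v` as far as possible, that is, scanning forward from `l`
along the inverse word of `v`: returns the last row that is reached and the initial part of `v`
that remains. -/
def scanBackward (A : ℕ → Letter g → Option ℕ) (l : ℕ) (v : List (Letter g)) :
    ℕ × List (Letter g) :=
  let p := scanForward A l (FreeGroup.invRev v)
  (p.1, FreeGroup.invRev p.2)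

/-- The forward scan followed by the backward scan, from the state `(k, v, l)`, where `k` and `l`
are the current values of the forward and backward scans and `v = y_f … y_b` is the part of the
word that has not been scanned. -/
def scanBoth (A : ℕ → Letter g → Option ℕ) (k : ℕ) (v : List (Letter g)) (l : ℕ) :
    ℕ × List (Letter g) × ℕ :=
  let p := scanForward A k v
  let q := scanBackward A l p.2
  (p.1, q.2, q.1)

/-- `Scan T k v l T'` says that procedure Scan, called with the table `T` for the relation
`k ^ v = l`, ends with the table `T'`. The counters of the procedure satisfy `f ≤ b` exactly when
the unscanned part `v = y_f … y_b` of the word is not empty. -/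
inductive Scan : Table R → ℕ → List (Letter g) → ℕ → Table R → Prop
  /-- The condition `f ≤ b` of the main loop fails. -/
  | finished {T : Table R} {k l : ℕ} : Scan T k [] l T
  /-- After both scans `f < b`: extend the forward scan by a definition and repeat. -/
  | gap {T T' : Table R} {k l k' l' : ℕ} {y z : Letter g} {v v' : List (Letter g)} :
      v ≠ [] → scanBoth T.A k v l = (k', y :: z :: v', l') →
      Scan (T.define k' y) k' (y :: z :: v') l' T' → Scan T k v l T'
  /-- After both scans `f = b`: the scans meet. -/
  | meet {T : Table R} {k l k' l' : ℕ} {y : Letter g} {v : List (Letter g)} :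
      v ≠ [] → scanBoth T.A k v l = (k', [y], l') → Scan T k v l (T.deduction k' y l')
  /-- After both scans `b < f` and the scans overlap incorrectly. -/
  | overlap {T T' : Table R} {k l k' l' : ℕ} {v : List (Letter g)} :
      v ≠ [] → scanBoth T.A k v l = (k', [], l') → k' ≠ l' → Coincidence T k' l' T' →
      Scan T k v l T'
  /-- After both scans `b < f` and the scan completes correctly. -/
  | correct {T : Table R} {k l k' : ℕ} {v : List (Letter g)} :
      v ≠ [] → scanBoth T.A k v l = (k', [], k') → Scan T k v l T

/-- The set `R_2` of the (reduced) secondary relations `bar u x_i u bar x_j`, for the primary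
relations `x_i ^ u = x_j`. -/
def secondary (R : Finset (Relation (Fin g))) : Finset (FreeGroup (Fin g)) :=
  R.image fun r => r.word⁻¹ * FreeGroup.of r.src * r.word * (FreeGroup.of r.tgt)⁻¹

/-- The first loop of Enumerate: scan the primary relations. -/
def ScanPrimary (T T' : Table R) : Prop :=
  ForEach R (fun r t t' => Scan t (rep t.ρ (genRow r.src)) r.word.toWord (rep t.ρ (genRow r.tgt)) t')
    T T'

/-- The body of the main loop of Enumerate for the row `i`: scan the secondary relations as long as
`i` is live (a dead row never becomes live again, so that leaving the loop is the same as skipping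
the remaining relations); then, if `i` is live, fill the undefined entries of row `i`. -/
def ProcessRow (i : ℕ) (T T' : Table R) : Prop :=
  ∃ T₁ : Table R,
    ForEach (secondary R)
      (fun w t t' => (i ∈ t.Ω ∧ Scan t i w.toWord i t') ∨ (i ∉ t.Ω ∧ t' = t)) T T₁ ∧
    ((i ∈ T₁.Ω ∧
        ForEach Finset.univ (fun y t t' => t' = if t.A i y = none then t.define i y else t) T₁ T') ∨
      (i ∉ T₁.Ω ∧ T' = T₁))

/-- Enumerate(S, R, M) completes and returns the table `T`. The inequality `i ≤ max Ω` is expressed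
as the existence of an element of `Ω` which is at least `i`. -/
def EnumerateCompletes (R : Finset (Relation (Fin g))) (M : ℕ) (T : Table R) : Prop :=
  ∃ (T₀ : Table R) (n : ℕ), ScanPrimary (Table.init R) T₀ ∧
    While (fun s : Table R × ℕ => (∃ j ∈ s.1.Ω, s.2 ≤ j) ∧ s.2 ≤ M)
      (fun s s' => ProcessRow s.2 s.1 s'.1 ∧ s'.2 = s.2 + 1) (T₀, 1) (T, n) ∧
    ¬ ∃ j ∈ T.Ω, n ≤ j

end Procedures

end RackEnum

/-! The enumeration is controlled from two sides. Entries i^y = j are written only when τ(j) =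
τ(i)^y, and rows are identified only when their labels agree (`Sound`), so nothing false in the
presented rack is recorded. Conversely nothing is lost: entries move to equivalent rows, but the old
table survives in the new one up to equivalence (`Ext`). The delicate point is Coincidence, where
each entry removed from a dead row is recreated at the representatives or implied by a merge
(`coincidenceStep_spec`). Hence a relation enforced by Scan (`Scan.spec`) persists through all later
coincidences.

On completion every live row is full and fixed by the secondary relators, and the primary relations
hold at the rows of the generators (`EnumerateCompletes.complete`). Full rows with entries in
inverse pairs give an action of F(S) on Ω, hence a map a^u ↦ Rep(a)^u from the free rack to Ω
(`Complete.ofFreeRack`). It is onto because every row is connected to a generator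
(`Complete.exists_act_eq`), it is constant on congruence classes (`Complete.cong`), and composed
with τ it is the quotient map (`Complete.τΩ_ofFreeRack`). So τ is a bijection on Ω. The rack
structure is transported along it, and the stated formulas hold because x_k^w acts as w̄ x_k w. -/

namespace RackEnum

/-! ### Representatives -/

section Rep

variable {ρ : ℕ → ℕ}

theorem rep_of_lt {j : ℕ} (h : ρ j < j) : rep ρ j = rep ρ (ρ j) := by
  rw [rep, if_pos h]

theorem rep_of_not_lt {j : ℕ} (h : ¬ ρ j < j) : rep ρ j = j := by
  rw [rep, if_neg h]

theorem rep_le (ρ : ℕ → ℕ) (j : ℕ) : rep ρ j ≤ j := by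
  induction j using Nat.strong_induction_on with
  | _ j ih =>
    by_cases h : ρ j < j
    · rw [rep_of_lt h]
      exact (ih _ h).trans h.le
    · rw [rep_of_not_lt h]

@[simp]
theorem rep_rep (ρ : ℕ → ℕ) (j : ℕ) : rep ρ (rep ρ j) = rep ρ j := by
  induction j using Nat.strong_induction_on with
  | _ j ih =>
    by_cases h : ρ j < j
    · rw [rep_of_lt h]
      exact ih _ h
    · rw [rep_of_not_lt h, rep_of_not_lt h]

theorem rep_eq_self_iff {j : ℕ} (h : ρ j ≤ j) : rep ρ j = j ↔ ρ j = j := by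
  constructor
  · intro h'
    by_contra hne
    have hlt : ρ j < j := lt_of_le_of_ne h hne
    have := rep_le ρ (ρ j)
    rw [rep_of_lt hlt] at h'
    omega
  · intro h'
    exact rep_of_not_lt (by omega)

/-- This is the effect of Merge on representatives: the orbits that meet the live row n are exactly
those that end there, and they are redirected to m. -/
theorem rep_functionUpdate {m n : ℕ} (hn : rep ρ n = n) (hm : rep ρ m = m) (h : m < n) (j : ℕ) :
    rep (Function.update ρ n m) j = if rep ρ j = n then m else rep ρ j := by
  induction j using Nat.strong_induction_on with
  | _ j ih =>
    by_cases hj : j = n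
    · subst hj
      rw [rep_of_lt (by simpa using h), Function.update_self, ih m h, hm, hn, if_neg h.ne, if_pos rfl]
    · have hu : Function.update ρ n m j = ρ j := Function.update_of_ne hj _ _
      by_cases hl : ρ j < j
      · rw [rep_of_lt (by rwa [hu]), hu, ih _ hl, rep_of_lt hl]
      · rw [rep_of_not_lt (by rwa [hu]), rep_of_not_lt hl, if_neg hj]

/-- Path compression: a shortcut to the end of an orbit does not change where orbits end. -/
theorem rep_functionUpdate_rep {n : ℕ} (h : rep ρ n < n) :
    rep (Function.update ρ n (rep ρ n)) = rep ρ := by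
  funext j
  induction j using Nat.strong_induction_on with
  | _ j ih =>
    by_cases hj : j = n
    · subst hj
      rw [rep_of_lt (by simpa using h), Function.update_self, ih _ h, rep_rep]
    · have hu : Function.update ρ n (rep ρ n) j = ρ j := Function.update_of_ne hj _ _
      by_cases hl : ρ j < j
      · rw [rep_of_lt (by rwa [hu]), hu, ih _ hl, rep_of_lt hl]
      · rw [rep_of_not_lt (by rwa [hu]), rep_of_not_lt hl]

/-- The loop alters ρ as it descends, so ρ is generalised in the induction. Compression preserves
representatives, so the fixed value written by the loop is still the representative of the next row.
-/
theorem updateLoop_spec (n : ℕ) : ∀ {ρ : ℕ → ℕ}, (∀ j, ρ j ≤ j) →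
    rep (updateLoop (rep ρ n) ρ n) = rep ρ ∧ ∀ j, updateLoop (rep ρ n) ρ n j ≤ j := by
  induction n using Nat.strong_induction_on with
  | _ n ih =>
    intro ρ hρ
    rw [updateLoop]
    split_ifs with h
    · have hlt : rep ρ n < n := by
        rw [rep_of_lt h]
        exact (rep_le _ _).trans_lt h
      have hrep := rep_functionUpdate_rep hlt
      have hle : ∀ j, Function.update ρ n (rep ρ n) j ≤ j := by
        intro j
        by_cases hj : j = n
        · subst hj
          simpa using hlt.le
        · rw [Function.update_of_ne hj]
          exact hρ j
      have key := ih (ρ n) h hle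
      rw [hrep, ← rep_of_lt h] at key
      exact key
    · exact ⟨rfl, hρ⟩

theorem rep_update (hρ : ∀ j, ρ j ≤ j) (i : ℕ) : rep (update ρ i) = rep ρ :=
  (updateLoop_spec i hρ).1

theorem update_le (hρ : ∀ j, ρ j ≤ j) (i j : ℕ) : update ρ i j ≤ j :=
  (updateLoop_spec i hρ).2 j

end Rep

/-! ### Letters and entries -/

section Entries

variable {g : ℕ}

@[simp]
theorem bar_bar (y : Letter g) : bar (bar y) = y := by
  simp [bar]

/-- Ensures that the two cells of an inverse pair are distinct even when both lie in the same row.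
-/
theorem bar_ne (y : Letter g) : bar y ≠ y := by
  intro h
  have := congrArg Prod.snd h
  simp [bar] at this

theorem setEntry_pair_eq_some {A : ℕ → Letter g → Option ℕ} {i j a b : ℕ} {y z : Letter g}
    (h : setEntry (setEntry A i y (some j)) j (bar y) (some i) a z = some b) :
    (a = i ∧ z = y ∧ b = j) ∨ (a = j ∧ z = bar y ∧ b = i) ∨ A a z = some b := by
  unfold setEntry at h
  split_ifs at h with h1 h2
  · right; left
    exact ⟨h1.1, h1.2, (Option.some.inj h).symm⟩
  · left
    exact ⟨h2.1, h2.2, (Option.some.inj h).symm⟩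
  · right; right
    exact h

theorem setEntry_pair_left (A : ℕ → Letter g → Option ℕ) (i j : ℕ) (y : Letter g) (v w : Option ℕ) :
    setEntry (setEntry A i y v) j (bar y) w i y = v := by
  simp [setEntry, (bar_ne y).symm]

theorem setEntry_pair_right (A : ℕ → Letter g → Option ℕ) (i j : ℕ) (y : Letter g)
    (v w : Option ℕ) : setEntry (setEntry A i y v) j (bar y) w j (bar y) = w := by
  simp [setEntry]

theorem setEntry_pair_of_ne {A : ℕ → Letter g → Option ℕ} {i j a : ℕ} {y z : Letter g}
    {v w : Option ℕ} (h₁ : ¬ (a = i ∧ z = y)) (h₂ : ¬ (a = j ∧ z = bar y)) :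
    setEntry (setEntry A i y v) j (bar y) w a z = A a z := by
  simp only [setEntry, if_neg h₁, if_neg h₂]

end Entries

/-! ### Inverse letters acting on the presented rack -/

section LetterAct

variable {g : ℕ} {R : Finset (Relation (Fin g))}

@[simp]
theorem letterAct_bar (x : PresentedRack R) (y : Letter g) :
    letterAct (letterAct x y) (bar y) = x := by
  obtain ⟨a, b⟩ := y
  cases b <;> simp [letterAct, bar]

theorem map_letterAct_bar {o p : Option (PresentedRack R)} {y : Letter g}
    (h : p = o.map fun x => letterAct x y) : o = p.map fun x => letterAct x (bar y) := by
  subst h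
  cases o <;> simp

end LetterAct

namespace Table

variable {g : ℕ} {R : Finset (Relation (Fin g))}

/-! ### Invariants of tables -/

/-- The properties of a table that hold at every moment of the enumeration. -/
structure Sound (T : Table R) : Prop where
  ρ_le : ∀ j, T.ρ j ≤ j
  rep_pos : ∀ j, 1 ≤ j → 1 ≤ rep T.ρ j
  rep_of_gt : ∀ j, T.ω < j → rep T.ρ j = j
  gens_le : g ≤ T.ω
  inv : ∀ {i y j}, T.A i y = some j → T.A j (bar y) = some i
  range : ∀ {i y j}, T.A i y = some j → 1 ≤ i ∧ i ≤ T.ω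
  τ_ne_none : ∀ i, 1 ≤ i → i ≤ T.ω → T.τ i ≠ none
  τ_entry : ∀ {i y j}, T.A i y = some j → T.τ j = (T.τ i).map fun x => letterAct x y
  τ_rep : ∀ i, T.τ (rep T.ρ i) = T.τ i
  τ_gen : ∀ k, T.τ (genRow k) = some (gen R k)

theorem Sound.range_right {T : Table R} (hT : T.Sound) {i j : ℕ} {y : Letter g}
    (h : T.A i y = some j) : 1 ≤ j ∧ j ≤ T.ω :=
  hT.range (hT.inv h)

theorem Sound.mem_Ω {T : Table R} (hT : T.Sound) {i : ℕ} :
    i ∈ T.Ω ↔ (1 ≤ i ∧ i ≤ T.ω) ∧ rep T.ρ i = i := by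
  rw [rep_eq_self_iff (hT.ρ_le i), and_assoc]
  rfl

theorem Sound.rep_range {T : Table R} (hT : T.Sound) {i : ℕ} (h : 1 ≤ i ∧ i ≤ T.ω) :
    1 ≤ rep T.ρ i ∧ rep T.ρ i ≤ T.ω :=
  ⟨hT.rep_pos i h.1, (rep_le _ _).trans h.2⟩

theorem Sound.rep_mem_Ω {T : Table R} (hT : T.Sound) {i : ℕ} (h : 1 ≤ i ∧ i ≤ T.ω) :
    rep T.ρ i ∈ T.Ω :=
  hT.mem_Ω.2 ⟨hT.rep_range h, rep_rep _ _⟩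

theorem Sound.genRow_range {T : Table R} (hT : T.Sound) (k : Fin g) :
    1 ≤ genRow k ∧ genRow k ≤ T.ω := by
  have := hT.gens_le
  have := k.isLt
  unfold genRow
  omega

/-- The table contains the entry `i ^ y = j`, up to replacing rows by equivalent ones. -/
def Represents (T : Table R) (i : ℕ) (y : Letter g) (j : ℕ) : Prop :=
  ∃ i' j', T.A i' y = some j' ∧ rep T.ρ i' = rep T.ρ i ∧ rep T.ρ j' = rep T.ρ j

theorem Represents.bar {T : Table R} (hT : T.Sound) {i j : ℕ} {y : Letter g}
    (h : T.Represents i y j) : T.Represents j (bar y) i := by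
  obtain ⟨i', j', h, hi, hj⟩ := h
  exact ⟨j', i', hT.inv h, hj, hi⟩

/-- The table `T'` contains, up to equivalence of rows, all the information of `T`. -/
structure Ext (T T' : Table R) : Prop where
  ω_le : T.ω ≤ T'.ω
  rep_eq : ∀ {j k}, rep T.ρ j = rep T.ρ k → rep T'.ρ j = rep T'.ρ k
  entry : ∀ {i y j}, T.A i y = some j → T'.Represents i y j

theorem Ext.refl (T : Table R) : Ext T T :=
  ⟨le_rfl, id, fun h => ⟨_, _, h, rfl, rfl⟩⟩

theorem Ext.represents {T T' : Table R} (h : Ext T T') {i j : ℕ} {y : Letter g}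
    (hr : T.Represents i y j) : T'.Represents i y j := by
  obtain ⟨i₁, j₁, h₁, hi₁, hj₁⟩ := hr
  obtain ⟨i₂, j₂, h₂, hi₂, hj₂⟩ := h.entry h₁
  exact ⟨i₂, j₂, h₂, hi₂.trans (h.rep_eq hi₁), hj₂.trans (h.rep_eq hj₁)⟩

theorem Ext.trans {T₁ T₂ T₃ : Table R} (h : Ext T₁ T₂) (h' : Ext T₂ T₃) : Ext T₁ T₃ :=
  ⟨h.ω_le.trans h'.ω_le, fun e => h'.rep_eq (h.rep_eq e), fun e => h'.represents (h.entry e)⟩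

/-- A row that is dead stays dead. -/
theorem Ext.rep_eq_self {T T' : Table R} (h : Ext T T') {j : ℕ} (hj : rep T'.ρ j = j) :
    rep T.ρ j = j := by
  -- The old representative of j keeps the same new representative as j; were it smaller than j, the
  -- latter could not be j.
  have h₁ : rep T'.ρ (rep T.ρ j) = rep T'.ρ j := h.rep_eq (rep_rep _ _)
  have h₂ := rep_le T'.ρ (rep T.ρ j)
  have h₃ := rep_le T.ρ j
  omega

/-- Rows that are connected to a generator by entries and equivalences of rows. -/
inductive Reach (T : Table R) : ℕ → Prop
  | gen (k : Fin g) : Reach T (genRow k)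
  | entry {i j : ℕ} {y : Letter g} : Reach T i → T.A i y = some j → Reach T j
  | equiv {i j : ℕ} : Reach T i → rep T.ρ i = rep T.ρ j → Reach T j

theorem Reach.mono {T T' : Table R} (h : Ext T T') {j : ℕ} (hj : T.Reach j) : T'.Reach j := by
  induction hj with
  | gen k => exact .gen k
  | entry _ e ih =>
    obtain ⟨i', j', e', hi, hj⟩ := h.entry e
    exact ((ih.equiv hi.symm).entry e').equiv hj
  | equiv _ e ih => exact ih.equiv (h.rep_eq e)

/-- The properties of a table that hold before and after each call of the procedures Define, Scan
and Coincidence. -/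
structure Inv (T : Table R) : Prop extends Sound T where
  reach : ∀ j, 1 ≤ j → j ≤ T.ω → T.Reach j
  live : ∀ {i y j}, T.A i y = some j → rep T.ρ i = i

/-! ### Elementary changes of tables -/

/-- Apart from `ρ_le`, the invariants see ρ only through representatives; hence Update is harmless.
-/
theorem Sound.of_rep_eq {T : Table R} (hT : T.Sound) {ρ : ℕ → ℕ} (hle : ∀ j, ρ j ≤ j)
    (hρ : rep ρ = rep T.ρ) : Sound { T with ρ := ρ } where
  ρ_le := hle
  rep_pos := by simpa only [hρ] using hT.rep_pos
  rep_of_gt := by simpa only [hρ] using hT.rep_of_gt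
  gens_le := hT.gens_le
  inv := hT.inv
  range := hT.range
  τ_ne_none := hT.τ_ne_none
  τ_entry := hT.τ_entry
  τ_rep := by simpa only [hρ] using hT.τ_rep
  τ_gen := hT.τ_gen

theorem undefine_eq_some {T : Table R} {d e i j : ℕ} {x y : Letter g} :
    (T.undefine d x e).A i y = some j ↔
      T.A i y = some j ∧ ¬ (i = d ∧ y = x) ∧ ¬ (i = e ∧ y = RackEnum.bar x) := by
  simp only [undefine, setEntry]
  split_ifs with h₁ h₂ <;> simp_all

theorem Sound.undefine {T : Table R} (hT : T.Sound) {d e : ℕ} {x : Letter g}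
    (h : T.A d x = some e) : (T.undefine d x e).Sound where
  ρ_le := hT.ρ_le
  rep_pos := hT.rep_pos
  rep_of_gt := hT.rep_of_gt
  gens_le := hT.gens_le
  inv := by
    intro i y j hij
    rw [undefine_eq_some] at hij ⊢
    obtain ⟨hij, h₁, h₂⟩ := hij
    refine ⟨hT.inv hij, ?_, ?_⟩
    -- If the inverse of a surviving entry were erased, that entry would itself be the other member
    -- of the erased pair.
    · rintro ⟨rfl, rfl⟩
      have := hT.inv hij
      rw [h] at this
      exact h₂ ⟨(Option.some.inj this).symm, (bar_bar y).symm⟩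
    · rintro ⟨rfl, hy⟩
      have hy : y = x := by simpa using congrArg RackEnum.bar hy
      subst hy
      have h₃ := hT.inv hij
      rw [hT.inv h] at h₃
      exact h₁ ⟨(Option.some.inj h₃).symm, rfl⟩
  range := fun hij => hT.range (undefine_eq_some.1 hij).1
  τ_ne_none := hT.τ_ne_none
  τ_entry := fun hij => hT.τ_entry (undefine_eq_some.1 hij).1
  τ_rep := hT.τ_rep
  τ_gen := hT.τ_gen

/-- Both cells must be empty: overwriting one would leave its former inverse entry unmatched. -/
theorem Sound.deduction {T : Table R} (hT : T.Sound) {i j : ℕ} {y : Letter g}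
    (hi : 1 ≤ i ∧ i ≤ T.ω) (hj : 1 ≤ j ∧ j ≤ T.ω) (hiy : T.A i y = none)
    (hjy : T.A j (RackEnum.bar y) = none) (hτ : T.τ j = (T.τ i).map fun x => letterAct x y) :
    (T.deduction i y j).Sound where
  ρ_le := hT.ρ_le
  rep_pos := hT.rep_pos
  rep_of_gt := hT.rep_of_gt
  gens_le := hT.gens_le
  inv := by
    intro a z b h
    rcases setEntry_pair_eq_some h with ⟨rfl, rfl, rfl⟩ | ⟨rfl, rfl, rfl⟩ | h'
    · exact setEntry_pair_right _ _ _ _ _ _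
    · rw [bar_bar]
      exact setEntry_pair_left _ _ _ _ _ _
    · have hb := hT.inv h'
      refine (setEntry_pair_of_ne ?_ ?_).trans hb
      · rintro ⟨rfl, hz⟩
        rw [hz, hiy] at hb
        exact absurd hb (by simp)
      · rintro ⟨rfl, hz⟩
        rw [hz, hjy] at hb
        exact absurd hb (by simp)
  range := by
    intro a z b h
    rcases setEntry_pair_eq_some h with ⟨rfl, rfl, rfl⟩ | ⟨rfl, rfl, rfl⟩ | h'
    · exact hi
    · exact hj
    · exact hT.range h'
  τ_ne_none := hT.τ_ne_none
  τ_entry := by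
    intro a z b h
    rcases setEntry_pair_eq_some h with ⟨rfl, rfl, rfl⟩ | ⟨rfl, rfl, rfl⟩ | h'
    · exact hτ
    · exact map_letterAct_bar hτ
    · exact hT.τ_entry h'
  τ_rep := hT.τ_rep
  τ_gen := hT.τ_gen

theorem deduction_self (T : Table R) (i : ℕ) (y : Letter g) (j : ℕ) :
    (T.deduction i y j).A i y = some j :=
  setEntry_pair_left _ _ _ _ _ _

theorem deduction_of_eq_some {T : Table R} {i j a b : ℕ} {y z : Letter g} (hiy : T.A i y = none)
    (hjy : T.A j (RackEnum.bar y) = none) (h : T.A a z = some b) :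
    (T.deduction i y j).A a z = some b := by
  refine (setEntry_pair_of_ne ?_ ?_).trans h
  · rintro ⟨rfl, rfl⟩
    simp [hiy] at h
  · rintro ⟨rfl, rfl⟩
    simp [hjy] at h

theorem ext_deduction {T : Table R} {i j : ℕ} {y : Letter g} (hiy : T.A i y = none)
    (hjy : T.A j (RackEnum.bar y) = none) : Ext T (T.deduction i y j) :=
  ⟨le_rfl, id, fun h => ⟨_, _, deduction_of_eq_some hiy hjy h, rfl, rfl⟩⟩

theorem Inv.deduction {T : Table R} (hT : T.Inv) {i j : ℕ} {y : Letter g} (hi : i ∈ T.Ω)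
    (hj : j ∈ T.Ω) (hiy : T.A i y = none) (hjy : T.A j (RackEnum.bar y) = none)
    (hτ : T.τ j = (T.τ i).map fun x => letterAct x y) : (T.deduction i y j).Inv where
  toSound := by
    rw [hT.mem_Ω] at hi hj
    exact hT.toSound.deduction hi.1 hj.1 hiy hjy hτ
  reach := fun k h₁ h₂ => (hT.reach k h₁ h₂).mono (ext_deduction hiy hjy)
  live := by
    rw [hT.mem_Ω] at hi hj
    intro a z b h
    rcases setEntry_pair_eq_some h with ⟨rfl, rfl, rfl⟩ | ⟨rfl, rfl, rfl⟩ | h'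
    · exact hi.2
    · exact hj.2
    · exact hT.live h'

/-- The table with a new row without entries, and with prescribed value of `τ` in the new row. -/
def addRow (T : Table R) (x : Option (PresentedRack R)) : Table R where
  ω := T.ω + 1
  A := T.A
  τ := Function.update T.τ (T.ω + 1) x
  ρ := Function.update T.ρ (T.ω + 1) (T.ω + 1)

/-- Nonexistent rows are already fixed by ρ, so creating one changes no representative. -/
theorem Sound.addRow_ρ {T : Table R} (hT : T.Sound) (x : Option (PresentedRack R)) :
    (T.addRow x).ρ = T.ρ := by
  refine Function.update_eq_self_iff.2 ?_
  have := hT.rep_of_gt (T.ω + 1) (by omega)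
  exact ((rep_eq_self_iff (hT.ρ_le _)).1 this).symm

theorem addRow_τ_of_le {T : Table R} {i : ℕ} (h : i ≤ T.ω) (x : Option (PresentedRack R)) :
    (T.addRow x).τ i = T.τ i :=
  Function.update_of_ne (by omega) _ _

theorem Sound.addRow {T : Table R} (hT : T.Sound) {x : Option (PresentedRack R)} (hx : x ≠ none) :
    (T.addRow x).Sound where
  ρ_le := by
    rw [hT.addRow_ρ]
    exact hT.ρ_le
  rep_pos := by
    rw [hT.addRow_ρ]
    exact hT.rep_pos
  rep_of_gt := by
    rw [hT.addRow_ρ]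
    exact fun j hj => hT.rep_of_gt j (lt_of_le_of_lt (Nat.le_succ _) hj)
  gens_le := hT.gens_le.trans (Nat.le_succ _)
  inv := hT.inv
  range := fun h => ⟨(hT.range h).1, (hT.range h).2.trans (Nat.le_succ _)⟩
  τ_ne_none := by
    intro i h₁ h₂
    by_cases hi : i ≤ T.ω
    · rw [addRow_τ_of_le hi]
      exact hT.τ_ne_none i h₁ hi
    · have : i = T.ω + 1 := le_antisymm h₂ (by omega)
      subst this
      simpa [Table.addRow] using hx
  τ_entry := by
    intro i y j h
    rw [addRow_τ_of_le (hT.range h).2, addRow_τ_of_le (hT.range_right h).2]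
    exact hT.τ_entry h
  τ_rep := by
    intro i
    rw [hT.addRow_ρ]
    by_cases hi : i ≤ T.ω
    · rw [addRow_τ_of_le hi, addRow_τ_of_le ((rep_le _ _).trans hi)]
      exact hT.τ_rep i
    · rw [hT.rep_of_gt i (by omega)]
  τ_gen := by
    intro k
    rw [addRow_τ_of_le (hT.genRow_range k).2]
    exact hT.τ_gen k

/-- Splits Define into an empty new row and a deduction, so that the lemmas on deductions apply. -/
theorem define_eq (T : Table R) (i : ℕ) (y : Letter g) :
    T.define i y =
      (T.addRow ((T.τ i).map fun x => letterAct x y)).deduction i y (T.ω + 1) :=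
  rfl

theorem Sound.entry_new_row {T : Table R} (hT : T.Sound) (y : Letter g) :
    T.A (T.ω + 1) y = none := by
  cases h : T.A (T.ω + 1) y with
  | none => rfl
  | some j =>
    have := (hT.range h).2
    omega

theorem Sound.ext_define {T : Table R} (hT : T.Sound) {i : ℕ} {y : Letter g}
    (hiy : T.A i y = none) : Ext T (T.define i y) := by
  have h₁ : Ext T (T.addRow ((T.τ i).map fun x => letterAct x y)) :=
    ⟨Nat.le_succ _, by rw [hT.addRow_ρ]; exact id, fun h => ⟨_, _, h, rfl, rfl⟩⟩
  exact h₁.trans (ext_deduction (T := T.addRow _) hiy (hT.entry_new_row _))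

theorem Sound.rep_define {T : Table R} (hT : T.Sound) (i : ℕ) (y : Letter g) :
    rep (T.define i y).ρ = rep T.ρ :=
  congrArg rep (hT.addRow_ρ ((T.τ i).map fun x => letterAct x y))

theorem define_self (T : Table R) (i : ℕ) (y : Letter g) :
    (T.define i y).A i y = some (T.ω + 1) := by
  rw [define_eq, deduction_self]

theorem Inv.define {T : Table R} (hT : T.Inv) {i : ℕ} {y : Letter g} (hi : i ∈ T.Ω)
    (hiy : T.A i y = none) : (T.define i y).Inv := by
  rw [hT.mem_Ω] at hi
  have hlt : i ≤ T.ω := hi.1.2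
  have hne : ((T.τ i).map fun x => letterAct x y) ≠ none := by
    simpa using hT.τ_ne_none i hi.1.1 hi.1.2
  have hext := hT.toSound.ext_define hiy
  refine { toSound := ?_, reach := ?_, live := ?_ }
  · refine (hT.toSound.addRow hne).deduction ⟨hi.1.1, hlt.trans (Nat.le_succ _)⟩
      ⟨Nat.succ_pos _, le_rfl⟩ hiy (hT.entry_new_row _) ?_
    rw [addRow_τ_of_le hlt]
    simp [Table.addRow]
  · intro j h₁ h₂
    by_cases hj : j ≤ T.ω
    · exact (hT.reach j h₁ hj).mono hext
    · have : j = T.ω + 1 := le_antisymm h₂ (by omega)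
      subst this
      exact ((hT.reach i hi.1.1 hlt).mono hext).entry (define_self T i y)
  · intro a z b h
    rw [hT.rep_define]
    rcases setEntry_pair_eq_some h with ⟨rfl, rfl, rfl⟩ | ⟨rfl, rfl, rfl⟩ | h'
    · exact hi.2
    · exact hT.rep_of_gt _ (Nat.lt_succ_self _)
    · exact hT.live h'

end Table

/-! ### Procedure Coincidence -/

section Coincidence

variable {g : ℕ} {R : Finset (Relation (Fin g))}

open Table

theorem merge_A (s : Table R × List ℕ) (m n : ℕ) : (merge s m n).1.A = s.1.A := by
  unfold merge
  dsimp only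
  split_ifs <;> rfl

theorem merge_ω (s : Table R × List ℕ) (m n : ℕ) : (merge s m n).1.ω = s.1.ω := by
  unfold merge
  dsimp only
  split_ifs <;> rfl

theorem merge_τ (s : Table R × List ℕ) (m n : ℕ) : (merge s m n).1.τ = s.1.τ := by
  unfold merge
  dsimp only
  split_ifs <;> rfl

/-- The formula also covers rows that are already equivalent, where maximum and minimum coincide. -/
theorem rep_merge (s : Table R × List ℕ) (m n j : ℕ) :
    rep (merge s m n).1.ρ j =
      if rep s.1.ρ j = max (rep s.1.ρ m) (rep s.1.ρ n) then min (rep s.1.ρ m) (rep s.1.ρ n)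
      else rep s.1.ρ j := by
  unfold merge
  dsimp only
  split_ifs with h h' h'
  · rw [h', h, max_self, min_self]
  · rfl
  · rw [rep_functionUpdate _ _ (min_lt_max.2 h), if_pos h']
    · rcases max_choice (rep s.1.ρ m) (rep s.1.ρ n) with e | e <;> rw [e, rep_rep]
    · rcases min_choice (rep s.1.ρ m) (rep s.1.ρ n) with e | e <;> rw [e, rep_rep]
  · rw [rep_functionUpdate _ _ (min_lt_max.2 h), if_neg h']
    · rcases max_choice (rep s.1.ρ m) (rep s.1.ρ n) with e | e <;> rw [e, rep_rep]
    · rcases min_choice (rep s.1.ρ m) (rep s.1.ρ n) with e | e <;> rw [e, rep_rep]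

theorem rep_merge_eq (s : Table R × List ℕ) (m n : ℕ) :
    rep (merge s m n).1.ρ m = rep (merge s m n).1.ρ n := by
  rw [rep_merge, rep_merge]
  rcases le_total (rep s.1.ρ m) (rep s.1.ρ n) with h | h
  · simp [max_eq_right h, min_eq_left h]
  · simp [max_eq_left h, min_eq_right h]

theorem mem_merge_of_mem {s : Table R × List ℕ} {m n j : ℕ} (h : j ∈ s.2) :
    j ∈ (merge s m n).2 := by
  unfold merge
  dsimp only
  split_ifs <;> simp [h]

/-- The only row that a merge kills is the larger representative, and that row is queued. -/
theorem rep_merge_eq_self_or_mem {s : Table R × List ℕ} {m n j : ℕ} (h : rep s.1.ρ j = j) :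
    rep (merge s m n).1.ρ j = j ∨ j ∈ (merge s m n).2 := by
  by_cases hj : j = max (rep s.1.ρ m) (rep s.1.ρ n)
  · by_cases hmn : rep s.1.ρ m = rep s.1.ρ n
    · left
      simpa [merge, hmn] using h
    · right
      simp [merge, hmn, hj]
  · left
    rw [rep_merge, h, if_neg hj]

theorem Table.Sound.merge {s : Table R × List ℕ} (hs : s.1.Sound) {m n : ℕ}
    (hm : 1 ≤ m ∧ m ≤ s.1.ω) (hn : 1 ≤ n ∧ n ≤ s.1.ω) (hτ : s.1.τ m = s.1.τ n) :
    (merge s m n).1.Sound where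
  ρ_le := by
    intro j
    unfold RackEnum.merge
    dsimp only
    split_ifs with h
    · exact hs.ρ_le j
    · dsimp only
      by_cases hj : j = max (rep s.1.ρ m) (rep s.1.ρ n)
      · subst hj
        rw [Function.update_self]
        exact min_le_max
      · rw [Function.update_of_ne hj]
        exact hs.ρ_le j
  rep_pos := by
    intro j hj
    rw [rep_merge]
    split_ifs
    · exact le_min (hs.rep_pos m hm.1) (hs.rep_pos n hn.1)
    · exact hs.rep_pos j hj
  rep_of_gt := by
    intro j hj
    rw [merge_ω] at hj
    have hm' := (hs.rep_range hm).2
    have hn' := (hs.rep_range hn).2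
    rw [rep_merge, hs.rep_of_gt j hj, if_neg]
    have := max_le hm' hn'
    omega
  gens_le := by
    rw [merge_ω]
    exact hs.gens_le
  inv := by
    rw [merge_A]
    exact hs.inv
  range := by
    rw [merge_A, merge_ω]
    exact hs.range
  τ_ne_none := by
    rw [merge_ω, merge_τ]
    exact hs.τ_ne_none
  τ_entry := by
    rw [merge_A, merge_τ]
    exact hs.τ_entry
  τ_rep := by
    intro i
    rw [merge_τ, rep_merge]
    have h₁ := hs.τ_rep m
    have h₂ := hs.τ_rep n
    have h₃ := hs.τ_rep i
    split_ifs with h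
    · rw [h] at h₃
      rw [← h₃]
      rcases le_total (rep s.1.ρ m) (rep s.1.ρ n) with h | h
      · rw [min_eq_left h, max_eq_right h, h₁, h₂, hτ]
      · rw [min_eq_right h, max_eq_left h, h₁, h₂, hτ]
    · exact h₃
  τ_gen := by
    rw [merge_τ]
    exact hs.τ_gen

theorem ext_merge (s : Table R × List ℕ) (m n : ℕ) : Ext s.1 (merge s m n).1 where
  ω_le := (merge_ω s m n).ge
  rep_eq := by
    intro j k h
    rw [rep_merge, rep_merge, h]
  entry := by
    intro i y j h
    exact ⟨i, j, by rwa [merge_A], rfl, rfl⟩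

/-- Every entry of the table is in a live row, or in a row of the queue, or satisfies `P`. -/
def Pending (P : ℕ → Letter g → Prop) (s : Table R × List ℕ) : Prop :=
  ∀ i y j, s.1.A i y = some j → rep s.1.ρ i = i ∨ i ∈ s.2 ∨ P i y

theorem Pending.merge {P : ℕ → Letter g → Prop} {s : Table R × List ℕ} (h : Pending P s) (m n : ℕ) :
    Pending P (merge s m n) := by
  intro i y j hij
  rw [merge_A] at hij
  rcases h i y j hij with h | h | h
  · rcases rep_merge_eq_self_or_mem (m := m) (n := n) h with h | h
    · exact .inl h
    · exact .inr (.inl h)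
  · exact .inr (.inl (mem_merge_of_mem h))
  · exact .inr (.inr h)

/-- The effect of one step of Coincidence. -/
theorem coincidenceStep_spec {d : ℕ} {x : Letter g} {l : List (Letter g)} {s : Table R × List ℕ}
    (hs : s.1.Sound) (hp : Pending (fun i y => i = d ∧ y ∈ x :: l) s) :
    (coincidenceStep d x s).1.Sound ∧ Ext s.1 (coincidenceStep d x s).1 ∧
      (coincidenceStep d x s).1.ω = s.1.ω ∧
      Pending (fun i y => i = d ∧ y ∈ l) (coincidenceStep d x s) := by
  obtain ⟨T, Q⟩ := s
  dsimp only at hs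
  cases hdx : T.A d x with
  | none =>
    have he : coincidenceStep d x (T, Q) = (T, Q) := by
      simp [coincidenceStep, hdx]
    rw [he]
    refine ⟨hs, .refl _, rfl, ?_⟩
    intro i y j hij
    rcases hp i y j hij with h | h | ⟨rfl, h⟩
    · exact .inl h
    · exact .inr (.inl h)
    · rcases List.mem_cons.1 h with rfl | h
      · simp [hdx] at hij
      · exact .inr (.inr ⟨rfl, h⟩)
  | some e =>
    have hd := hs.range hdx
    have he := hs.range_right hdx
    set ρ₂ := update T.ρ d with hρ₂
    have hrep₂ : rep ρ₂ = rep T.ρ := rep_update hs.ρ_le d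
    set ρ₃ := update ρ₂ e with hρ₃
    -- Both calls of Update are path compressions, so all representatives are still those of `T`.
    have hrep₃ : rep ρ₃ = rep T.ρ := (rep_update (update_le hs.ρ_le d) e).trans hrep₂
    have hle₃ : ∀ j, ρ₃ j ≤ j := update_le (update_le hs.ρ_le d) e
    set T₃ : Table R := { T.undefine d x e with ρ := ρ₃ } with hT₃
    have hS₃ : T₃.Sound := (hs.undefine hdx).of_rep_eq hle₃ hrep₃
    have hr₃ : rep T₃.ρ = rep T.ρ := hrep₃
    have hA₃ : ∀ {i y j}, T₃.A i y = some j ↔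
        T.A i y = some j ∧ ¬ (i = d ∧ y = x) ∧ ¬ (i = e ∧ y = RackEnum.bar x) :=
      undefine_eq_some
    have hp₃ : Pending (fun i y => i = d ∧ y ∈ l) (T₃, Q) := by
      intro i y j hij
      obtain ⟨hij, h₁, -⟩ := hA₃.1 hij
      dsimp only
      rw [hr₃]
      rcases hp i y j hij with h | h | ⟨rfl, h⟩
      · exact .inl h
      · exact .inr (.inl h)
      · rcases List.mem_cons.1 h with rfl | h
        · exact absurd ⟨rfl, rfl⟩ h₁
        · exact .inr (.inr ⟨rfl, h⟩)
    -- Only d^x = e and its inverse have been erased, so it suffices that the final table represents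
    -- this one entry.
    have hext : ∀ {T' : Table R}, T'.Sound → Ext T₃ T' → T'.Represents d x e → Ext T T' := by
      intro T' hS' hE hrep
      refine ⟨hE.ω_le, ?_, ?_⟩
      · intro j k h
        exact hE.rep_eq (by rwa [hr₃])
      · intro i y j hij
        by_cases h₁ : i = d ∧ y = x
        · obtain ⟨rfl, rfl⟩ := h₁
          rw [hdx] at hij
          exact Option.some.inj hij ▸ hrep
        by_cases h₂ : i = e ∧ y = RackEnum.bar x
        · obtain ⟨rfl, rfl⟩ := h₂
          rw [hs.inv hdx] at hij
          exact Option.some.inj hij ▸ hrep.bar hS'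
        exact hE.entry (hA₃.2 ⟨hij, h₁, h₂⟩)
    set δ := rep T.ρ d with hδ
    set ε := rep T.ρ e with hε
    have hdr : 1 ≤ δ ∧ δ ≤ T₃.ω := hs.rep_range hd
    have her : 1 ≤ ε ∧ ε ≤ T₃.ω := hs.rep_range he
    have hδδ : rep T₃.ρ δ = rep T₃.ρ d := by rw [hr₃, hδ, rep_rep]
    have hεε : rep T₃.ρ ε = rep T₃.ρ e := by rw [hr₃, hε, rep_rep]
    -- This compatibility of labels justifies all three outcomes: either merge, or the new pair of
    -- entries.
    have hτ : T₃.τ ε = (T₃.τ δ).map fun z => letterAct z x := by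
      change T.τ ε = (T.τ δ).map fun z => letterAct z x
      rw [hδ, hε, hs.τ_rep, hs.τ_rep, hs.τ_entry hdx]
    have hstep : coincidenceStep d x (T, Q) =
        match T₃.A δ x with
        | some f => merge (T₃, Q) ε f
        | none =>
          match T₃.A ε (RackEnum.bar x) with
          | some f => merge (T₃, Q) δ f
          | none => (T₃.deduction δ x ε, Q) := by
      have h' : rep (update T.ρ d) e = ε := congrFun hrep₂ e
      simp only [coincidenceStep, hdx, Table.undefine, h']
      rfl
    rw [hstep]
    clear hstep
    cases h₁ : T₃.A δ x with
    | some f =>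
      dsimp only
      have hS' : (merge (T₃, Q) ε f).1.Sound := by
        refine hS₃.merge (s := (T₃, Q)) her (hS₃.range_right h₁) ?_
        rw [hτ]
        exact (hS₃.τ_entry h₁).symm
      have hE := ext_merge (T₃, Q) ε f
      refine ⟨hS', hext hS' hE ?_, merge_ω _ _ _, hp₃.merge _ _⟩
      -- After merging ε with f, the existing entry δ^x = f stands for the erased d^x = e.
      refine ⟨δ, f, by rwa [merge_A], hE.rep_eq hδδ, ?_⟩
      rw [← rep_merge_eq]
      exact hE.rep_eq hεε
    | none =>
      dsimp only
      cases h₂ : T₃.A ε (RackEnum.bar x) with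
      | some f =>
        dsimp only
        have hS' : (merge (T₃, Q) δ f).1.Sound := by
          refine hS₃.merge (s := (T₃, Q)) hdr (hS₃.range_right h₂) ?_
          exact (map_letterAct_bar hτ).trans (hS₃.τ_entry h₂).symm
        have hE := ext_merge (T₃, Q) δ f
        refine ⟨hS', hext hS' hE ?_, merge_ω _ _ _, hp₃.merge _ _⟩
        refine ⟨f, ε, ?_, ?_, hE.rep_eq hεε⟩
        · rw [merge_A]
          simpa using hS₃.inv h₂
        · rw [← rep_merge_eq]
          exact hE.rep_eq hδδ
      | none =>
        dsimp only
        have hS' := hS₃.deduction hdr her h₁ h₂ hτ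
        refine ⟨hS', hext hS' (ext_deduction h₁ h₂)
          ⟨δ, ε, deduction_self _ _ _ _, hδδ, hεε⟩, rfl, ?_⟩
        intro i y j hij
        rcases setEntry_pair_eq_some hij with ⟨rfl, rfl, rfl⟩ | ⟨rfl, rfl, rfl⟩ | h'
        · exact .inl (by rw [← hr₃] at hδ; exact hδδ.trans hδ.symm)
        · exact .inl (by rw [← hr₃] at hε; exact hεε.trans hε.symm)
        · exact hp₃ i y j h'

/-- Each column that is treated leaves the set of exceptional cells of row d, until none remains. -/
theorem coincidence_forList {d : ℕ} {l : List (Letter g)} {s s' : Table R × List ℕ}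
    (h : ForList (fun x t t' => t' = coincidenceStep d x t) l s s')
    (hs : s.1.Sound) (hp : Pending (fun i y => i = d ∧ y ∈ l) s) :
    s'.1.Sound ∧ Ext s.1 s'.1 ∧ s'.1.ω = s.1.ω ∧ Pending (fun _ _ => False) s' := by
  induction h with
  | nil => exact ⟨hs, .refl _, rfl, by simpa using hp⟩
  | cons hb _ ih =>
    subst hb
    obtain ⟨h₁, h₂, h₃, h₄⟩ := coincidenceStep_spec hs hp
    obtain ⟨h₅, h₆, h₇, h₈⟩ := ih h₁ h₄
    exact ⟨h₅, h₂.trans h₆, h₇.trans h₃, h₈⟩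

theorem coincidence_while {s s' : Table R × List ℕ}
    (h : While (fun s : Table R × List ℕ => s.2 ≠ [])
      (fun s s' => ∃ d Q, s.2 = d :: Q ∧
        ForEach Finset.univ (fun x t t' => t' = coincidenceStep d x t) (s.1, Q) s') s s')
    (hs : s.1.Sound) (hp : Pending (fun _ _ => False) s) :
    s'.1.Sound ∧ Ext s.1 s'.1 ∧ s'.1.ω = s.1.ω ∧ Pending (fun _ _ => False) s' := by
  induction h with
  | done _ => exact ⟨hs, .refl _, rfl, hp⟩
  | @step s _ _ _ hb _ ih =>
    obtain ⟨d, Q, hQ, l, -, hl, hf⟩ := hb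
    -- Taking d from the queue turns its cells into the exceptional ones; the list `l` contains
    -- every column.
    have hp' : Pending (fun i y => i = d ∧ y ∈ l) (s.1, Q) := by
      intro i y j hij
      rcases hp i y j hij with h | h | h
      · exact .inl h
      · rw [hQ] at h
        rcases List.mem_cons.1 h with h | h
        · exact .inr (.inr ⟨h, (hl y).2 (Finset.mem_univ y)⟩)
        · exact .inr (.inl h)
      · exact h.elim
    obtain ⟨h₁, h₂, h₃, h₄⟩ := coincidence_forList hf hs hp'
    obtain ⟨h₅, h₆, h₇, h₈⟩ := ih h₁ h₄
    exact ⟨h₅, h₂.trans h₆, h₇.trans h₃, h₈⟩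

theorem Coincidence.spec {T T' : Table R} {m n : ℕ} (h : Coincidence T m n T') (hT : T.Inv)
    (hm : 1 ≤ m ∧ m ≤ T.ω) (hn : 1 ≤ n ∧ n ≤ T.ω) (hτ : T.τ m = T.τ n) :
    T'.Inv ∧ Ext T T' ∧ rep T'.ρ m = rep T'.ρ n := by
  have hS : (merge (T, []) m n).1.Sound := hT.toSound.merge (s := (T, [])) hm hn hτ
  have hp : Pending (fun _ _ => False) (merge (T, []) m n) :=
    Pending.merge (s := (T, [])) (fun i y j hij => .inl (hT.live hij)) m n
  obtain ⟨h₁, h₂, h₃, h₄⟩ := coincidence_while h hS hp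
  have hE : Ext T T' := (ext_merge (T, []) m n).trans h₂
  rw [merge_ω] at h₃
  refine ⟨{ toSound := h₁, reach := ?_, live := ?_ }, hE, h₂.rep_eq (rep_merge_eq _ _ _)⟩
  · intro j hj hj'
    exact (hT.reach j hj (hj'.trans h₃.le)).mono hE
  · intro i y j hij
    -- The queue is empty now, so every remaining entry is in a live row.
    simpa using h₄ i y j hij

end Coincidence

/-! ### Words acting on the presented rack -/

section ListAct

variable {g : ℕ} {R : Finset (Relation (Fin g))}

/-- The action of a word on the presented rack. -/
def listAct (x : PresentedRack R) (w : List (Letter g)) : PresentedRack R :=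
  w.foldl letterAct x

theorem listAct_append (x : PresentedRack R) (v w : List (Letter g)) :
    listAct x (v ++ w) = listAct (listAct x v) w :=
  List.foldl_append

theorem letterAct_mk (x : FreeRack (Fin g)) (y : Letter g) :
    letterAct (Quotient.mk (congSetoid R) x : PresentedRack R) y =
      Quotient.mk (congSetoid R) ⟨x.base, x.exponent * FreeGroup.mk [y]⟩ := by
  obtain ⟨a, b⟩ := y
  cases b
  · change Quotient.mk (congSetoid R) (⟨x.base, x.exponent * 1⁻¹ * (FreeGroup.of a)⁻¹ * 1⟩ :
      FreeRack (Fin g)) = _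
    simp [FreeGroup.of, FreeGroup.inv_mk, FreeGroup.invRev]
  · change Quotient.mk (congSetoid R) (⟨x.base, x.exponent * 1⁻¹ * FreeGroup.of a * 1⟩ :
      FreeRack (Fin g)) = _
    simp [FreeGroup.of]

theorem listAct_mk (w : List (Letter g)) : ∀ x : FreeRack (Fin g),
    listAct (Quotient.mk (congSetoid R) x : PresentedRack R) w =
      Quotient.mk (congSetoid R) ⟨x.base, x.exponent * FreeGroup.mk w⟩ := by
  induction w with
  | nil =>
    intro x
    rw [← FreeGroup.one_eq_mk, mul_one]
    rfl
  | cons y w ih =>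
    intro x
    change listAct (letterAct _ y) w = _
    rw [letterAct_mk, ih, mul_assoc, FreeGroup.mul_mk, List.singleton_append]

/-- A word multiplies exponents on the right, so only its class in the free group matters. -/
theorem listAct_congr (x : PresentedRack R) {v w : List (Letter g)}
    (h : FreeGroup.mk v = FreeGroup.mk w) : listAct x v = listAct x w := by
  obtain ⟨x, rfl⟩ := Quotient.exists_rep x
  rw [listAct_mk, listAct_mk, h]

theorem listAct_gen_primary {r : Relation (Fin g)} (hr : r ∈ R) :
    listAct (gen R r.src) r.word.toWord = gen R r.tgt := by
  rw [gen, listAct_mk, FreeGroup.mk_toWord, one_mul]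
  exact Quotient.sound (Cong.rel r hr)

theorem listAct_secondary {w : FreeGroup (Fin g)} (hw : w ∈ secondary R) (x : PresentedRack R) :
    listAct x w.toWord = x := by
  obtain ⟨r, hr, rfl⟩ := Finset.mem_image.1 hw
  obtain ⟨x, rfl⟩ := Quotient.exists_rep x
  rw [listAct_mk, FreeGroup.mk_toWord]
  refine Quotient.sound ?_
  -- Since x_i^u and x_j are congruent, they act alike; undoing the action of x_j then leaves x
  -- fixed.
  have h₁ := Cong.act (Cong.refl (R := R) x) (Cong.rel r hr)
  have h₂ := Cong.invAct h₁ (Cong.refl ⟨r.tgt, 1⟩)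
  rw [Rack.left_inv] at h₂
  change Cong R _ _
  convert h₂ using 1
  ext1
  · rfl
  · simp only [Shelf.act, Rack.invAct]
    group

end ListAct

/-! ### Evaluation of words in a table -/

section EvalWord

variable {g : ℕ} {R : Finset (Relation (Fin g))}

theorem evalWord_cons (A : ℕ → Letter g → Option ℕ) (j : ℕ) (y : Letter g) (w : List (Letter g)) :
    evalWord A j (y :: w) = (A j y).bind fun k => evalWord A k w := rfl

theorem evalWord_append (A : ℕ → Letter g → Option ℕ) (u v : List (Letter g)) : ∀ j : ℕ,
    evalWord A j (u ++ v) = (evalWord A j u).bind fun k => evalWord A k v := by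
  induction u with
  | nil => intro j; rfl
  | cons y u ih =>
    intro j
    rw [List.cons_append, evalWord_cons, evalWord_cons, Option.bind_assoc]
    simp only [ih]

theorem evalWord_append_of_eq_some {A : ℕ → Letter g → Option ℕ} {u v : List (Letter g)}
    {j k : ℕ} (h : evalWord A j u = some k) : evalWord A j (u ++ v) = evalWord A k v := by
  rw [evalWord_append, h, Option.bind_some]

theorem evalWord_cons_eq_some {A : ℕ → Letter g → Option ℕ} {j k : ℕ} {y : Letter g}
    {w : List (Letter g)} :
    evalWord A j (y :: w) = some k ↔ ∃ m, A j y = some m ∧ evalWord A m w = some k := by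
  rw [evalWord_cons, Option.bind_eq_some_iff]

theorem invRev_cons (y : Letter g) (w : List (Letter g)) :
    FreeGroup.invRev (y :: w) = FreeGroup.invRev w ++ [bar y] := by
  simp [FreeGroup.invRev, bar]

theorem invRev_append (u v : List (Letter g)) :
    FreeGroup.invRev (u ++ v) = FreeGroup.invRev v ++ FreeGroup.invRev u := by
  simp [FreeGroup.invRev]

namespace Table

theorem Sound.evalWord_invRev {T : Table R} (hT : T.Sound) {w : List (Letter g)} :
    ∀ {j k : ℕ}, evalWord T.A j w = some k → evalWord T.A k (FreeGroup.invRev w) = some j := by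
  induction w with
  | nil =>
    intro j k h
    exact (congrArg some (Option.some.inj h).symm)
  | cons y w ih =>
    intro j k h
    obtain ⟨m, h₁, h₂⟩ := evalWord_cons_eq_some.1 h
    rw [invRev_cons, evalWord_append_of_eq_some (ih h₂), evalWord_cons, hT.inv h₁]
    rfl

theorem Sound.τ_evalWord {T : Table R} (hT : T.Sound) {w : List (Letter g)} :
    ∀ {j k : ℕ}, evalWord T.A j w = some k → T.τ k = (T.τ j).map fun x => listAct x w := by
  induction w with
  | nil =>
    intro j k h
    rw [Option.some.inj h]
    simp [listAct]
  | cons y w ih =>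
    intro j k h
    obtain ⟨m, h₁, h₂⟩ := evalWord_cons_eq_some.1 h
    rw [ih h₂, hT.τ_entry h₁, Option.map_map]
    rfl

theorem Inv.mem_Ω_of_entry {T : Table R} (hT : T.Inv) {i j : ℕ} {y : Letter g}
    (h : T.A i y = some j) : j ∈ T.Ω :=
  hT.mem_Ω.2 ⟨hT.range_right h, hT.live (hT.inv h)⟩

theorem Inv.evalWord_mem_Ω {T : Table R} (hT : T.Inv) {w : List (Letter g)} :
    ∀ {j k : ℕ}, j ∈ T.Ω → evalWord T.A j w = some k → k ∈ T.Ω := by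
  induction w with
  | nil =>
    intro j k hj h
    exact Option.some.inj h ▸ hj
  | cons y w ih =>
    intro j k _ h
    obtain ⟨m, h₁, h₂⟩ := evalWord_cons_eq_some.1 h
    exact ih (hT.mem_Ω_of_entry h₁) h₂

/-- Entries of `T'` join live rows only, so an entry known up to equivalence sits exactly at the
representatives. -/
theorem Ext.entry_rep {T T' : Table R} (h : Ext T T') (hT' : T'.Inv) {i j : ℕ} {y : Letter g}
    (hij : T.A i y = some j) : T'.A (rep T'.ρ i) y = some (rep T'.ρ j) := by
  obtain ⟨i', j', e, hi, hj⟩ := h.entry hij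
  rw [← hi, ← hj, hT'.live e, hT'.live (hT'.inv e), e]

theorem Ext.evalWord_rep {T T' : Table R} (h : Ext T T') (hT' : T'.Inv) {w : List (Letter g)} :
    ∀ {j k : ℕ}, evalWord T.A j w = some k →
      evalWord T'.A (rep T'.ρ j) w = some (rep T'.ρ k) := by
  induction w with
  | nil =>
    intro j k e
    rw [Option.some.inj e]
    rfl
  | cons y w ih =>
    intro j k e
    obtain ⟨m, h₁, h₂⟩ := evalWord_cons_eq_some.1 e
    rw [evalWord_cons, h.entry_rep hT' h₁]
    exact ih h₂

theorem Ext.rep_rep {T T' : Table R} (h : Ext T T') (j : ℕ) :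
    rep T'.ρ (rep T.ρ j) = rep T'.ρ j :=
  h.rep_eq (RackEnum.rep_rep _ _)

end Table

/-! ### Procedure Scan -/

theorem scanForward_spec (A : ℕ → Letter g → Option ℕ) (v : List (Letter g)) : ∀ k : ℕ,
    ∃ u, v = u ++ (scanForward A k v).2 ∧ evalWord A k u = some (scanForward A k v).1 ∧
      ∀ y v', (scanForward A k v).2 = y :: v' → A (scanForward A k v).1 y = none := by
  induction v with
  | nil =>
    intro k
    exact ⟨[], rfl, rfl, by simp [scanForward]⟩
  | cons y v ih =>
    intro k
    cases h : A k y with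
    | none =>
      refine ⟨[], ?_⟩
      simp only [scanForward, h]
      refine ⟨rfl, rfl, ?_⟩
      rintro z v' ⟨⟩
      exact h
    | some m =>
      obtain ⟨u, h₁, h₂, h₃⟩ := ih m
      refine ⟨y :: u, ?_⟩
      simp only [scanForward, h]
      refine ⟨congrArg (y :: ·) h₁, ?_, h₃⟩
      rw [evalWord_cons, h]
      exact h₂

theorem scanBackward_spec {T : Table R} (hT : T.Sound) (l : ℕ) (v : List (Letter g)) :
    ∃ u, v = (scanBackward T.A l v).2 ++ u ∧ evalWord T.A (scanBackward T.A l v).1 u = some l ∧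
      ∀ y v', (scanBackward T.A l v).2 = v' ++ [y] →
        T.A (scanBackward T.A l v).1 (bar y) = none := by
  obtain ⟨u, h₁, h₂, h₃⟩ := scanForward_spec T.A (FreeGroup.invRev v) l
  refine ⟨FreeGroup.invRev u, ?_, hT.evalWord_invRev h₂, ?_⟩
  · have := congrArg FreeGroup.invRev h₁
    rwa [FreeGroup.invRev_invRev, invRev_append] at this
  · intro y v' h
    have h' := congrArg FreeGroup.invRev h
    rw [invRev_append] at h'
    simp only [scanBackward, FreeGroup.invRev_invRev] at h'
    exact h₃ (bar y) (FreeGroup.invRev v') h'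

/-- The empty cells at the ends of the unscanned part are what permits a subsequent definition or
deduction. -/
theorem scanBoth_spec {T : Table R} (hT : T.Sound) {k l k' l' : ℕ} {v v' : List (Letter g)}
    (h : scanBoth T.A k v l = (k', v', l')) :
    ∃ u₁ u₂, v = u₁ ++ v' ++ u₂ ∧ evalWord T.A k u₁ = some k' ∧ evalWord T.A l' u₂ = some l ∧
      (∀ y w, v' = y :: w → T.A k' y = none) ∧
      ∀ y w, v' = w ++ [y] → T.A l' (bar y) = none := by
  obtain ⟨u₁, h₁, h₂, h₃⟩ := scanForward_spec T.A v k
  obtain ⟨u₂, h₄, h₅, h₆⟩ := scanBackward_spec hT l (scanForward T.A k v).2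
  simp only [scanBoth, Prod.mk.injEq] at h
  obtain ⟨rfl, rfl, rfl⟩ := h
  refine ⟨u₁, u₂, ?_, h₂, h₅, ?_, h₆⟩
  · rw [List.append_assoc, ← h₄, ← h₁]
  · intro y w hw
    rw [hw] at h₄
    exact h₃ y _ h₄

/-- Cancelling the two scanned ends turns the label condition for the whole word into one for the
unscanned middle. -/
theorem τ_middle {T : Table R} (hT : T.Sound) {k l k' l' : ℕ} {u₁ v u₂ : List (Letter g)}
    (hτ : T.τ l = (T.τ k).map fun x => listAct x (u₁ ++ v ++ u₂))
    (h₁ : evalWord T.A k u₁ = some k') (h₂ : evalWord T.A l' u₂ = some l) :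
    T.τ l' = (T.τ k').map fun x => listAct x v := by
  rw [hT.τ_evalWord (hT.evalWord_invRev h₂), hτ, hT.τ_evalWord h₁, Option.map_map, Option.map_map]
  congr 1
  funext x
  simp only [Function.comp_apply]
  rw [← listAct_append, ← listAct_append]
  refine listAct_congr _ ?_
  simp only [← FreeGroup.mul_mk, ← FreeGroup.inv_mk]
  group

theorem Scan.spec {T T' : Table R} {k l : ℕ} {v : List (Letter g)} (h : Scan T k v l T')
    (hT : T.Inv) (hk : k ∈ T.Ω) (hl : l ∈ T.Ω) (hv : v = [] → k = l)
    (hτ : T.τ l = (T.τ k).map fun x => listAct x v) :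
    T'.Inv ∧ Table.Ext T T' ∧ evalWord T'.A (rep T'.ρ k) v = some (rep T'.ρ l) := by
  -- The scanned ends survive in the final table, so only the unscanned middle has to be traced
  -- there.
  have compose : ∀ {T T' : Table R} {k l k' l' : ℕ} {u₁ v u₂ : List (Letter g)},
      T'.Inv → Table.Ext T T' → evalWord T.A k u₁ = some k' → evalWord T.A l' u₂ = some l →
      evalWord T'.A (rep T'.ρ k') v = some (rep T'.ρ l') →
      evalWord T'.A (rep T'.ρ k) (u₁ ++ v ++ u₂) = some (rep T'.ρ l) := by
    intro T T' k l k' l' u₁ v u₂ hT' hE h₁ h₂ h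
    rw [List.append_assoc, evalWord_append_of_eq_some (hE.evalWord_rep hT' h₁),
      evalWord_append_of_eq_some h, hE.evalWord_rep hT' h₂]
  induction h with
  | finished =>
    -- Scan never compares the two rows for the empty word; their equality must come from the
    -- hypothesis.
    rw [hv rfl]
    exact ⟨hT, .refl _, rfl⟩
  | @gap T T' k l k' l' y z v v' _ hs _ ih =>
    obtain ⟨u₁, u₂, rfl, h₁, h₂, h₃, -⟩ := scanBoth_spec hT.toSound hs
    have hk' := hT.evalWord_mem_Ω hk h₁
    have hl' := hT.evalWord_mem_Ω hl (hT.evalWord_invRev h₂)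
    have hy := h₃ y _ rfl
    have hE := hT.toSound.ext_define hy
    have hmem : ∀ {i}, i ∈ T.Ω → i ∈ (T.define k' y).Ω := by
      intro i hi
      rw [(hT.define hk' hy).mem_Ω, hT.rep_define]
      rw [hT.mem_Ω] at hi
      exact ⟨⟨hi.1.1, hi.1.2.trans hE.ω_le⟩, hi.2⟩
    have hdτ : ∀ {i}, i ∈ T.Ω → (T.define k' y).τ i = T.τ i :=
      fun hi => Table.addRow_τ_of_le (hT.mem_Ω.1 hi).1.2 _
    have hτ' := τ_middle hT.toSound hτ h₁ h₂
    obtain ⟨hI, hE', he⟩ := ih (hT.define hk' hy) (hmem hk') (hmem hl') (by simp)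
      (by rw [hdτ hk', hdτ hl', hτ'])
    exact ⟨hI, hE.trans hE', compose hI (hE.trans hE') h₁ h₂ he⟩
  | @meet T k l k' l' y v _ hs =>
    obtain ⟨u₁, u₂, rfl, h₁, h₂, h₃, h₄⟩ := scanBoth_spec hT.toSound hs
    have hk' := hT.evalWord_mem_Ω hk h₁
    have hl' := hT.evalWord_mem_Ω hl (hT.evalWord_invRev h₂)
    have hy := h₃ y _ rfl
    have hy' := h₄ y [] rfl
    have hE := Table.ext_deduction hy hy'
    have hI := hT.deduction hk' hl' hy hy' (τ_middle hT.toSound hτ h₁ h₂)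
    refine ⟨hI, hE, compose hI hE h₁ h₂ ?_⟩
    change evalWord _ (rep T.ρ k') _ = some (rep T.ρ l')
    rw [(hT.mem_Ω.1 hk').2, (hT.mem_Ω.1 hl').2, evalWord_cons, Table.deduction_self]
    rfl
  | @overlap T T' k l k' l' v _ hs _ hc =>
    obtain ⟨u₁, u₂, rfl, h₁, h₂, -, -⟩ := scanBoth_spec hT.toSound hs
    have hk' := hT.evalWord_mem_Ω hk h₁
    have hl' := hT.evalWord_mem_Ω hl (hT.evalWord_invRev h₂)
    have hτ' := τ_middle hT.toSound hτ h₁ h₂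
    obtain ⟨hI, hE, he⟩ := hc.spec hT (hT.mem_Ω.1 hk').1 (hT.mem_Ω.1 hl').1
      (by simpa [listAct] using hτ'.symm)
    exact ⟨hI, hE, compose hI hE h₁ h₂ (congrArg some he)⟩
  | @correct T k l k' v _ hs =>
    obtain ⟨u₁, u₂, rfl, h₁, h₂, -, -⟩ := scanBoth_spec hT.toSound hs
    exact ⟨hT, .refl _, compose hT (.refl _) h₁ h₂ rfl⟩

end EvalWord

/-! ### Enumeration -/

/-- `P` is a loop invariant, `E` the growth of the state, and `F x` the fact that iteration x
establishes and later growth preserves. -/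
theorem ForList.invariant {α σ : Type*} {body : α → σ → σ → Prop} {P : σ → Prop}
    {E : σ → σ → Prop} {F : α → σ → Prop} {l : List α} {s s' : σ} (hl : ForList body l s s')
    (refl : ∀ s, E s s) (trans : ∀ s t u, E s t → E t u → E s u)
    (mono : ∀ x s t, F x s → E s t → P t → F x t)
    (step : ∀ x ∈ l, ∀ s t, P s → body x s t → P t ∧ E s t ∧ F x t) (hs : P s) :
    P s' ∧ E s s' ∧ ∀ x ∈ l, F x s' := by
  induction hl with
  | nil => exact ⟨hs, refl _, by simp⟩
  | @cons x l s t u hb _ ih =>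
    obtain ⟨h₁, h₂, h₃⟩ := step x (by simp) _ _ hs hb
    obtain ⟨h₄, h₅, h₆⟩ := ih (fun y hy => step y (by simp [hy])) h₁
    refine ⟨h₄, trans _ _ _ h₂ h₅, ?_⟩
    intro y hy
    rcases List.mem_cons.1 hy with rfl | hy
    · exact mono _ _ _ h₃ h₅ h₄
    · exact h₆ y hy

section Enumerate

variable {g : ℕ} {R : Finset (Relation (Fin g))}

namespace Table

theorem inv_init (R : Finset (Relation (Fin g))) : (Table.init R).Inv where
  ρ_le := fun j => le_rfl
  rep_pos := fun j hj => by rwa [rep_of_not_lt (lt_irrefl _)]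
  rep_of_gt := fun j _ => rep_of_not_lt (lt_irrefl _)
  gens_le := le_rfl
  inv := by simp [Table.init]
  range := by simp [Table.init]
  τ_ne_none := fun i h₁ h₂ => by simpa [Table.init] using ⟨h₁, h₂⟩
  τ_entry := by simp [Table.init]
  τ_rep := fun i => by rw [rep_of_not_lt (lt_irrefl _)]
  τ_gen := fun k => by
    have := k.isLt
    simp [Table.init, genRow]
  reach := by
    intro j h₁ h₂
    obtain ⟨j, rfl⟩ := Nat.exists_eq_add_of_le' h₁
    exact .gen ⟨j, h₂⟩
  live := by simp [Table.init]

/-- The primary relation `r` holds in the table. -/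
def Primary (T : Table R) (r : Relation (Fin g)) : Prop :=
  evalWord T.A (rep T.ρ (genRow r.src)) r.word.toWord = some (rep T.ρ (genRow r.tgt))

theorem Primary.mono {T T' : Table R} {r : Relation (Fin g)} (h : T.Primary r) (hE : Ext T T')
    (hT' : T'.Inv) : T'.Primary r := by
  have := hE.evalWord_rep hT' h
  rwa [hE.rep_rep, hE.rep_rep] at this

/-- The row `i` is dead, or `i ^ w = i`. -/
def Closes (i : ℕ) (w : List (Letter g)) (T : Table R) : Prop :=
  rep T.ρ i = i → evalWord T.A i w = some i

theorem Closes.mono {T T' : Table R} {i : ℕ} {w : List (Letter g)} (h : Closes i w T)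
    (hE : Ext T T') (hT' : T'.Inv) : Closes i w T' := by
  intro hi
  have := hE.evalWord_rep hT' (h (hE.rep_eq_self hi))
  rwa [hi] at this

/-- The row `i` is dead, or `i ^ y` is defined. -/
def Filled (i : ℕ) (y : Letter g) (T : Table R) : Prop :=
  rep T.ρ i = i → ∃ j, T.A i y = some j

theorem Filled.mono {T T' : Table R} {i : ℕ} {y : Letter g} (h : Filled i y T)
    (hE : Ext T T') (hT' : T'.Inv) : Filled i y T' := by
  intro hi
  obtain ⟨j, hj⟩ := h (hE.rep_eq_self hi)
  have := hE.entry_rep hT' hj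
  rw [hi] at this
  exact ⟨_, this⟩

/-- The row `i` has been processed: it is dead, or it is complete and satisfies the secondary
relations. -/
def Processed (i : ℕ) (T : Table R) : Prop :=
  (∀ w ∈ secondary R, Closes i w.toWord T) ∧ ∀ y, Filled i y T

theorem Processed.mono {T T' : Table R} {i : ℕ} (h : Processed i T)
    (hE : Ext T T') (hT' : T'.Inv) : Processed i T' :=
  ⟨fun w hw => (h.1 w hw).mono hE hT', fun y => (h.2 y).mono hE hT'⟩

end Table

open Table

theorem ScanPrimary.spec (hR : ∀ r ∈ R, r.word = 1 → r.src = r.tgt) {T T' : Table R}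
    (h : ScanPrimary T T') (hT : T.Inv) : T'.Inv ∧ ∀ r ∈ R, T'.Primary r := by
  obtain ⟨l, -, hl, hf⟩ := h
  have := hf.invariant (P := Table.Inv) (E := Table.Ext) (F := fun r t => t.Primary r)
    Ext.refl (fun _ _ _ => Ext.trans) (fun _ _ _ => Primary.mono) ?_ hT
  · exact ⟨this.1, fun r hr => this.2.2 r ((hl r).2 hr)⟩
  · intro r hr s t hs hb
    have hr := (hl r).1 hr
    obtain ⟨h₁, h₂, h₃⟩ := hb.spec hs (hs.rep_mem_Ω (hs.genRow_range _))
      (hs.rep_mem_Ω (hs.genRow_range _))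
      -- The restriction on relations with empty word is needed exactly here.
      (fun hw => by rw [hR r hr (FreeGroup.toWord_eq_nil_iff.1 hw)])
      (by rw [hs.τ_rep, hs.τ_rep, hs.τ_gen, hs.τ_gen, Option.map_some, listAct_gen_primary hr])
    refine ⟨h₁, h₂, ?_⟩
    rwa [h₂.rep_rep, h₂.rep_rep] at h₃

theorem ProcessRow.spec {T T' : Table R} {i : ℕ} (h : ProcessRow i T T') (hT : T.Inv)
    (hi : 1 ≤ i ∧ i ≤ T.ω) : T'.Inv ∧ Ext T T' ∧ Processed i T' := by
  obtain ⟨T₁, ⟨l, -, hl, hf⟩, h⟩ := h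
  -- The bound on i makes failure to be in `t.Ω` mean that i is dead, which renders all conditions
  -- on row i vacuous.
  have h₁ := hf.invariant (P := fun t => t.Inv ∧ i ≤ t.ω) (E := Table.Ext)
    (F := fun (w : FreeGroup (Fin g)) t => Closes i w.toWord t) Ext.refl
    (fun _ _ _ => Ext.trans) (fun _ _ _ hF hE hP => Closes.mono hF hE hP.1) ?_ ⟨hT, hi.2⟩
  · obtain ⟨⟨hT₁, hi₁⟩, hE, hw⟩ := h₁
    rcases h with ⟨hlive, l', -, hl', hf'⟩ | ⟨hdead, rfl⟩
    · have h₂ := hf'.invariant (P := fun t => t.Inv ∧ i ∈ t.Ω) (E := Table.Ext)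
        (F := fun y t => Filled i y t) Ext.refl (fun _ _ _ => Ext.trans)
        (fun _ _ _ hF hE hP => hF.mono hE hP.1) ?_ ⟨hT₁, hlive⟩
      · obtain ⟨⟨hT', -⟩, hE', hy⟩ := h₂
        exact ⟨hT', hE.trans hE', fun w hws => (hw w ((hl w).2 hws)).mono hE' hT',
          fun y => hy y ((hl' y).2 (Finset.mem_univ y))⟩
      · rintro y - s t ⟨hs, his⟩ rfl
        split_ifs with hy
        · have hE' := hs.toSound.ext_define hy
          have hI := hs.define his hy
          refine ⟨⟨hI, ?_⟩, hE', fun _ => ⟨_, define_self s i y⟩⟩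
          rw [hI.mem_Ω, hs.rep_define]
          rw [hs.mem_Ω] at his
          exact ⟨⟨his.1.1, his.1.2.trans hE'.ω_le⟩, his.2⟩
        · exact ⟨⟨hs, his⟩, .refl _, fun _ => Option.ne_none_iff_exists'.1 hy⟩
    · have hne : rep T'.ρ i ≠ i := fun h => hdead (hT₁.mem_Ω.2 ⟨⟨hi.1, hi₁⟩, h⟩)
      exact ⟨hT₁, hE, fun w hws => hw w ((hl w).2 hws), fun y h => absurd h hne⟩
  · rintro w hw s t ⟨hs, his⟩ (⟨hlive, hb⟩ | ⟨hdead, rfl⟩)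
    · obtain ⟨h₁, h₂, h₃⟩ := hb.spec hs hlive hlive (fun _ => rfl)
        (by simp [listAct_secondary ((hl w).1 hw)])
      refine ⟨⟨h₁, his.trans h₂.ω_le⟩, h₂, fun h => ?_⟩
      rwa [h] at h₃
    · exact ⟨⟨hs, his⟩, .refl _, fun h => absurd (hs.mem_Ω.2 ⟨⟨hi.1, his⟩, h⟩) hdead⟩

/-- The properties of the table returned by a complete enumeration. -/
structure Table.Complete (T : Table R) : Prop extends Inv T where
  primary : ∀ r ∈ R, T.Primary r
  processed : ∀ i ∈ T.Ω, Processed i T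

theorem enumerate_while {M : ℕ} {s s' : Table R × ℕ}
    (h : While (fun s : Table R × ℕ => (∃ j ∈ s.1.Ω, s.2 ≤ j) ∧ s.2 ≤ M)
      (fun s s' => ProcessRow s.2 s.1 s'.1 ∧ s'.2 = s.2 + 1) s s')
    (hs : s.1.Inv) (hn : 1 ≤ s.2) (hp : ∀ i, 1 ≤ i → i < s.2 → Processed i s.1) :
    s'.1.Inv ∧ Ext s.1 s'.1 ∧ ∀ i, 1 ≤ i → i < s'.2 → Processed i s'.1 := by
  induction h with
  | done _ => exact ⟨hs, .refl _, hp⟩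
  | @step s t u hc hb _ ih =>
    obtain ⟨⟨j, hj, hle⟩, -⟩ := hc
    obtain ⟨h₁, h₂, h₃⟩ := hb.1.spec hs ⟨hn, hle.trans (hs.mem_Ω.1 hj).1.2⟩
    obtain ⟨h₄, h₅, h₆⟩ := ih h₁ (by omega) (by
      intro i hi hlt
      rcases Nat.lt_succ_iff_lt_or_eq.1 (hlt.trans_eq hb.2) with h | rfl
      · exact (hp i hi h).mono h₂ h₁
      · exact h₃)
    exact ⟨h₄, h₂.trans h₅, h₆⟩

theorem EnumerateCompletes.complete (hR : ∀ r ∈ R, r.word = 1 → r.src = r.tgt) {M : ℕ}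
    {T : Table R} (h : EnumerateCompletes R M T) : T.Complete := by
  obtain ⟨T₀, n, h₀, hw, hn⟩ := h
  obtain ⟨hI₀, hprim⟩ := h₀.spec hR (inv_init R)
  obtain ⟨hI, hE, hp⟩ := enumerate_while hw hI₀ le_rfl
    (fun i h₁ h₂ => absurd h₁ (not_le.2 h₂))
  exact { toInv := hI
          primary := fun r hr => (hprim r hr).mono hE hI
          -- Completion means that no live row is at or beyond the counter n.
          processed := fun i hi => hp i hi.1 (not_le.1 fun h => hn ⟨i, hi, h⟩) }

end Enumerate

/-! ### The action of the free group on the live rows of a complete table -/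

section Final

variable {g : ℕ} {R : Finset (Relation (Fin g))}

namespace Table

theorem Complete.exists_entry {T : Table R} (hT : T.Complete) {i : ℕ} (hi : i ∈ T.Ω)
    (y : Letter g) : ∃ j ∈ T.Ω, T.A i y = some j := by
  obtain ⟨j, hj⟩ := (hT.processed i hi).2 y (hT.mem_Ω.1 hi).2
  exact ⟨j, hT.mem_Ω_of_entry hj, hj⟩

theorem Complete.exists_evalWord {T : Table R} (hT : T.Complete) (w : List (Letter g)) :
    ∀ {i : ℕ}, i ∈ T.Ω → ∃ j ∈ T.Ω, evalWord T.A i w = some j := by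
  induction w with
  | nil => exact fun {i} hi => ⟨i, hi, rfl⟩
  | cons y w ih =>
    intro i hi
    obtain ⟨j, hj, h⟩ := hT.exists_entry hi y
    obtain ⟨k, hk, h'⟩ := ih hj
    exact ⟨k, hk, evalWord_cons_eq_some.2 ⟨j, h, h'⟩⟩

/-- In a full table each letter can be followed and then undone by its inverse entry, so cancelling
pairs do not matter; hence the free group acts. -/
theorem Complete.evalWord_red {T : Table R} (hT : T.Complete) {v w : List (Letter g)}
    (h : FreeGroup.Red v w) {i : ℕ} (hi : i ∈ T.Ω) : evalWord T.A i v = evalWord T.A i w := by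
  induction h with
  | refl => rfl
  | tail _ hs ih =>
    refine ih.trans ?_
    cases hs with
    | @not u v a b =>
      obtain ⟨j, hj, h⟩ := hT.exists_evalWord u hi
      obtain ⟨k, -, h'⟩ := hT.exists_entry hj (a, b)
      rw [evalWord_append_of_eq_some h, evalWord_append_of_eq_some h, evalWord_cons, h',
        Option.bind_some, evalWord_cons, show (a, !b) = bar (a, b) from rfl, hT.inv h',
        Option.bind_some]

theorem Complete.pow_mk {T : Table R} (hT : T.Complete) (w : List (Letter g)) {i : ℕ}
    (hi : i ∈ T.Ω) : T.pow i (FreeGroup.mk w) = evalWord T.A i w := by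
  rw [pow, FreeGroup.toWord_mk]
  exact (hT.evalWord_red FreeGroup.reduce.red hi).symm

theorem Complete.exists_pow {T : Table R} (hT : T.Complete) (i : T.Ω) (u : FreeGroup (Fin g)) :
    ∃ j : T.Ω, T.pow i u = some j.1 := by
  obtain ⟨j, hj, h⟩ := hT.exists_evalWord u.toWord i.2
  exact ⟨⟨j, hj⟩, h⟩

/-- The action of the free group on the live rows of a complete table. -/
noncomputable def Complete.act {T : Table R} (hT : T.Complete) (i : T.Ω)
    (u : FreeGroup (Fin g)) : T.Ω :=
  (hT.exists_pow i u).choose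

theorem Complete.pow_eq {T : Table R} (hT : T.Complete) (i : T.Ω) (u : FreeGroup (Fin g)) :
    T.pow i u = some (hT.act i u).1 :=
  (hT.exists_pow i u).choose_spec

theorem Complete.act_eq_iff {T : Table R} (hT : T.Complete) {i j : T.Ω} {u : FreeGroup (Fin g)} :
    hT.act i u = j ↔ T.pow i u = some j.1 := by
  rw [hT.pow_eq, Option.some_inj, Subtype.ext_iff]

@[simp]
theorem Complete.act_one {T : Table R} (hT : T.Complete) (i : T.Ω) : hT.act i 1 = i := by
  rw [hT.act_eq_iff, pow, FreeGroup.toWord_one]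
  rfl

theorem Complete.act_mul {T : Table R} (hT : T.Complete) (i : T.Ω) (u v : FreeGroup (Fin g)) :
    hT.act i (u * v) = hT.act (hT.act i u) v := by
  have h : evalWord T.A i u.toWord = some (hT.act i u).1 := hT.pow_eq i u
  rw [hT.act_eq_iff, ← hT.pow_eq]
  conv_lhs => rw [← u.mk_toWord, ← v.mk_toWord, FreeGroup.mul_mk]
  rw [hT.pow_mk _ i.2, evalWord_append_of_eq_some h]
  rfl

@[simp]
theorem Complete.act_act_inv {T : Table R} (hT : T.Complete) (i : T.Ω) (u : FreeGroup (Fin g)) :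
    hT.act (hT.act i u) u⁻¹ = i := by
  rw [← hT.act_mul, mul_inv_cancel, hT.act_one]

@[simp]
theorem Complete.act_inv_act {T : Table R} (hT : T.Complete) (i : T.Ω) (u : FreeGroup (Fin g)) :
    hT.act (hT.act i u⁻¹) u = i := by
  rw [← hT.act_mul, inv_mul_cancel, hT.act_one]

theorem Complete.act_inv_congr {T : Table R} (hT : T.Complete) {u v : FreeGroup (Fin g)}
    (h : ∀ i, hT.act i u = hT.act i v) (i : T.Ω) : hT.act i u⁻¹ = hT.act i v⁻¹ := by
  rw [← hT.act_act_inv (hT.act i u⁻¹) v, ← h, hT.act_inv_act]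

/-- The live row that represents a generator. -/
def Complete.genLive {T : Table R} (hT : T.Complete) (k : Fin g) : T.Ω :=
  ⟨rep T.ρ (genRow k), hT.rep_mem_Ω (hT.genRow_range k)⟩

/-- Representatives only decrease, so a generator row is represented by a generator row. -/
theorem Complete.exists_genRow {T : Table R} (hT : T.Complete) (k : Fin g) :
    ∃ k' : Fin g, (hT.genLive k).1 = genRow k' := by
  have h₁ : 1 ≤ rep T.ρ (genRow k) := hT.rep_pos _ (hT.genRow_range k).1
  have h₂ : rep T.ρ (genRow k) ≤ k.val + 1 := rep_le _ _
  have hk := k.isLt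
  refine ⟨⟨rep T.ρ (genRow k) - 1, by omega⟩, ?_⟩
  change rep T.ρ (genRow k) = rep T.ρ (genRow k) - 1 + 1
  omega

theorem Complete.genLive_eq {T : Table R} (hT : T.Complete) {k : Fin g} (h : genRow k ∈ T.Ω) :
    hT.genLive k = ⟨genRow k, h⟩ :=
  Subtype.ext (hT.mem_Ω.1 h).2

theorem Complete.exists_act_eq {T : Table R} (hT : T.Complete) (i : T.Ω) :
    ∃ k u, hT.act (hT.genLive k) u = i := by
  -- A connecting chain may pass through dead rows, so the induction speaks of representatives.
  have key : ∀ {j}, T.Reach j → 1 ≤ j ∧ j ≤ T.ω →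
      ∃ k u, (hT.act (hT.genLive k) u).1 = rep T.ρ j := by
    intro j hj
    induction hj with
    | gen k => exact fun _ => ⟨k, 1, by rw [hT.act_one]; rfl⟩
    | @entry i j y _ hij ih =>
      intro _
      obtain ⟨k, u, hu⟩ := ih (hT.range hij)
      rw [hT.live hij] at hu
      refine ⟨k, u * FreeGroup.mk [y], ?_⟩
      have h : hT.act (hT.act (hT.genLive k) u) (FreeGroup.mk [y]) =
          ⟨j, hT.mem_Ω_of_entry hij⟩ := by
        rw [hT.act_eq_iff, hT.pow_mk _ (Subtype.prop _), hu, evalWord_cons, hij]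
        rfl
      rw [hT.act_mul, h]
      exact (hT.live (hT.inv hij)).symm
    | @equiv i j _ hij ih =>
      intro hj
      rw [← hij]
      -- Row 0 and rows beyond ω are never equivalent to an existing row, so i exists because j
      -- does.
      refine ih ⟨?_, ?_⟩
      · by_contra h
        have h₁ := hT.rep_pos j hj.1
        have h₂ := rep_le T.ρ i
        omega
      · by_contra h
        have h₁ := hT.rep_of_gt i (by omega)
        have h₂ := rep_le T.ρ j
        omega
  have hi := hT.mem_Ω.1 i.2
  obtain ⟨k, u, h⟩ := key (hT.reach i hi.1.1 hi.1.2) hi.1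
  exact ⟨k, u, Subtype.ext (h.trans hi.2)⟩

/-! ### The map from the free rack to the live rows -/

/-- The element of the free group by which an element of the free rack acts. -/
def _root_.RackEnum.FreeRack.operator {S : Type*} (x : FreeRack S) : FreeGroup S :=
  x.exponent⁻¹ * FreeGroup.of x.base * x.exponent

/-- The map from the free rack to the live rows that sends `a ^ u` to the row reached along `u` from
the row of `a`. -/
noncomputable def Complete.ofFreeRack {T : Table R} (hT : T.Complete) (x : FreeRack (Fin g)) :
    T.Ω :=
  hT.act (hT.genLive x.base) x.exponent

theorem Complete.ofFreeRack_mk_mul {T : Table R} (hT : T.Complete) (x : FreeRack (Fin g))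
    (u : FreeGroup (Fin g)) :
    hT.ofFreeRack ⟨x.base, x.exponent * u⟩ = hT.act (hT.ofFreeRack x) u :=
  hT.act_mul _ _ _

theorem _root_.RackEnum.FreeRack.act_eq {S : Type*} (x y : FreeRack S) :
    y ◃ x = ⟨x.base, x.exponent * y.operator⟩ := by
  ext1
  · rfl
  · simp only [FreeRack.operator, Shelf.act, mul_assoc]

theorem _root_.RackEnum.FreeRack.invAct_eq {S : Type*} (x y : FreeRack S) :
    y ◃⁻¹ x = ⟨x.base, x.exponent * y.operator⁻¹⟩ := by
  ext1
  · rfl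
  · simp only [FreeRack.operator, Rack.invAct]
    group

theorem Complete.act_secondary {T : Table R} (hT : T.Complete) {w : FreeGroup (Fin g)}
    (hw : w ∈ secondary R) (i : T.Ω) : hT.act i w = i :=
  hT.act_eq_iff.2 ((hT.processed i i.2).1 w hw (hT.mem_Ω.1 i.2).2)

/-- The two claims must be proved together: y ◃ x depends on y only through its operator. For a
defining relation, the primary scan gives the first and the secondary one the second; conjugation
carries operators through both operations. -/
theorem Complete.cong {T : Table R} (hT : T.Complete) {x y : FreeRack (Fin g)} (h : Cong R x y) :
    hT.ofFreeRack x = hT.ofFreeRack y ∧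
      ∀ i, hT.act i x.operator = hT.act i y.operator := by
  induction h with
  | rel r hr =>
    refine ⟨?_, fun i => ?_⟩
    · rw [ofFreeRack, ofFreeRack, hT.act_one, hT.act_eq_iff]
      exact hT.primary r hr
    · have h := hT.act_secondary (Finset.mem_image_of_mem _ hr) i
      rw [hT.act_mul] at h
      have h' := congrArg (fun j => hT.act j (FreeGroup.of r.tgt)) h
      simp only [hT.act_inv_act] at h'
      simpa [FreeRack.operator] using h'
  | refl => exact ⟨rfl, fun _ => rfl⟩
  | symm _ ih => exact ⟨ih.1.symm, fun i => (ih.2 i).symm⟩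
  | trans _ _ ih₁ ih₂ => exact ⟨ih₁.1.trans ih₂.1, fun i => (ih₁.2 i).trans (ih₂.2 i)⟩
  | @act x x' y y' _ _ ihx ihy =>
    have hop : ∀ x y : FreeRack (Fin g),
        (y ◃ x).operator = y.operator⁻¹ * x.operator * y.operator := by
      intro x y
      rw [FreeRack.act_eq]
      simp only [FreeRack.operator]
      group
    refine ⟨?_, fun i => ?_⟩
    · rw [FreeRack.act_eq, FreeRack.act_eq, hT.ofFreeRack_mk_mul, hT.ofFreeRack_mk_mul, ihx.1, ihy.2]
    · simp only [hop, hT.act_mul, ihx.2, ihy.2, hT.act_inv_congr ihy.2]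
  | @invAct x x' y y' _ _ ihx ihy =>
    have hop : ∀ x y : FreeRack (Fin g),
        (y ◃⁻¹ x).operator = y.operator * x.operator * y.operator⁻¹ := by
      intro x y
      rw [FreeRack.invAct_eq]
      simp only [FreeRack.operator]
      group
    have hinv := hT.act_inv_congr ihy.2
    refine ⟨?_, fun i => ?_⟩
    · rw [FreeRack.invAct_eq, FreeRack.invAct_eq, hT.ofFreeRack_mk_mul, hT.ofFreeRack_mk_mul,
        ihx.1, hinv]
    · simp only [hop, hT.act_mul, ihx.2, ihy.2, hinv]

/-! ### The isomorphism with the presented rack -/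

theorem Complete.exists_τ {T : Table R} (hT : T.Complete) (i : T.Ω) :
    ∃ x, T.τ i.1 = some x :=
  Option.ne_none_iff_exists'.1 (hT.τ_ne_none i i.2.1 i.2.2.1)

/-- The restriction of `τ` to the live rows of a complete table. -/
noncomputable def Complete.τΩ {T : Table R} (hT : T.Complete) (i : T.Ω) : PresentedRack R :=
  (hT.exists_τ i).choose

theorem Complete.τ_eq {T : Table R} (hT : T.Complete) (i : T.Ω) : T.τ i.1 = some (hT.τΩ i) :=
  (hT.exists_τ i).choose_spec

/-- Labels follow entries: starting from the label of a generator, the path along u ends at the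
class of a^u. -/
theorem Complete.τΩ_ofFreeRack {T : Table R} (hT : T.Complete) (x : FreeRack (Fin g)) :
    hT.τΩ (hT.ofFreeRack x) = Quotient.mk (congSetoid R) x := by
  refine Option.some.inj ((hT.τ_eq _).symm.trans ?_)
  have h : evalWord T.A (hT.genLive x.base).1 x.exponent.toWord = some (hT.ofFreeRack x).1 :=
    hT.pow_eq _ _
  rw [hT.τ_evalWord h, genLive, hT.τ_rep, hT.τ_gen, Option.map_some, gen, listAct_mk,
    FreeGroup.mk_toWord, one_mul]

theorem Complete.exists_ofFreeRack_eq {T : Table R} (hT : T.Complete) (i : T.Ω) :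
    ∃ x, hT.ofFreeRack x = i := by
  obtain ⟨k, u, h⟩ := hT.exists_act_eq i
  exact ⟨⟨k, u⟩, h⟩

/-- Rows with equal labels come from congruent elements of the free rack, which `Complete.cong`
sends to the same row. -/
theorem Complete.τΩ_bijective {T : Table R} (hT : T.Complete) : Function.Bijective hT.τΩ := by
  constructor
  · intro i j h
    obtain ⟨x, rfl⟩ := hT.exists_ofFreeRack_eq i
    obtain ⟨y, rfl⟩ := hT.exists_ofFreeRack_eq j
    rw [hT.τΩ_ofFreeRack, hT.τΩ_ofFreeRack] at h
    exact (hT.cong (Quotient.exact h)).1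
  · intro z
    obtain ⟨x, rfl⟩ := Quotient.exists_rep z
    exact ⟨_, hT.τΩ_ofFreeRack x⟩

/-- Every row comes from the free rack, where the operation is right multiplication of the exponent
by the operator. -/
theorem Complete.τΩ_act {T : Table R} (hT : T.Complete) (i : T.Ω) (x : FreeRack (Fin g)) :
    hT.τΩ (hT.act i x.operator) = hT.τΩ (hT.ofFreeRack x) ◃ hT.τΩ i := by
  obtain ⟨y, rfl⟩ := hT.exists_ofFreeRack_eq i
  rw [← hT.ofFreeRack_mk_mul, hT.τΩ_ofFreeRack, hT.τΩ_ofFreeRack, hT.τΩ_ofFreeRack,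
    ← FreeRack.act_eq]
  rfl

theorem Complete.τΩ_act_inv {T : Table R} (hT : T.Complete) (i : T.Ω) (x : FreeRack (Fin g)) :
    hT.τΩ (hT.act i x.operator⁻¹) = hT.τΩ (hT.ofFreeRack x) ◃⁻¹ hT.τΩ i := by
  obtain ⟨y, rfl⟩ := hT.exists_ofFreeRack_eq i
  rw [← hT.ofFreeRack_mk_mul, hT.τΩ_ofFreeRack, hT.τΩ_ofFreeRack, hT.τΩ_ofFreeRack,
    ← FreeRack.invAct_eq]
  rfl

end Table

/-- The rack structure transported along a bijection. -/
abbrev rackOfEquiv {α β : Type*} [Rack β] (e : α ≃ β) : Rack α where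
  act y x := e.symm (e y ◃ e x)
  invAct y x := e.symm (e y ◃⁻¹ e x)
  self_distrib := by
    intro x y z
    simp only [Equiv.apply_symm_apply]
    rw [Shelf.self_distrib]
  left_inv := by
    intro y x
    simp
  right_inv := by
    intro y x
    simp

end Final

end RackEnum

theorem mainTheorem1 (g : ℕ) (R : Finset (RackEnum.Relation (Fin g)))
    (hR : ∀ r ∈ R, r.word = 1 → r.src = r.tgt)
    (M : ℕ) (T : RackEnum.Table R) (hT : RackEnum.EnumerateCompletes R M T) :
    (∀ j : T.Ω, ∃ (k : Fin g) (w : FreeGroup (Fin g)),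
      RackEnum.genRow k ∈ T.Ω ∧ T.pow (RackEnum.genRow k) w = some j.1) ∧
    ∃ _ : Rack T.Ω,
      (∀ (i j : T.Ω) (k : Fin g) (w : FreeGroup (Fin g)),
        RackEnum.genRow k ∈ T.Ω → T.pow (RackEnum.genRow k) w = some j.1 →
          T.pow i.1 (w⁻¹ * FreeGroup.of k * w) = some (j ◃ i : T.Ω).1 ∧
          T.pow i.1 (w⁻¹ * (FreeGroup.of k)⁻¹ * w) = some (j ◃⁻¹ i : T.Ω).1) ∧
      ∃ f : T.Ω →◃ RackEnum.PresentedRack R,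
        (∀ i : T.Ω, T.τ i.1 = some (f i)) ∧ Function.Bijective f ∧
        ∀ i j : T.Ω, f (j ◃⁻¹ i) = f j ◃⁻¹ f i := by
  have hC := hT.complete hR
  let e : T.Ω ≃ RackEnum.PresentedRack R := Equiv.ofBijective hC.τΩ hC.τΩ_bijective
  -- With the transported structure τ is an isomorphism by construction; what remains is that the
  -- operations agree with the table formulas.
  let rackΩ : Rack T.Ω := RackEnum.rackOfEquiv e
  refine ⟨fun j => ?_, rackΩ, fun i j k w hk hw => ?_,
    ⟨hC.τΩ, fun {x y} => e.apply_symm_apply (e x ◃ e y)⟩, hC.τ_eq, hC.τΩ_bijective,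
    fun i j => e.apply_symm_apply (e j ◃⁻¹ e i)⟩
  · obtain ⟨k, u, rfl⟩ := hC.exists_act_eq j
    obtain ⟨k', hk'⟩ := hC.exists_genRow k
    refine ⟨k', u, hk' ▸ (hC.genLive k).2, ?_⟩
    rw [← hk']
    exact hC.pow_eq _ _
  -- Thus j is the image of x_k^w, whose operator is the word in the formula. The label of the
  -- result involves only i and j, so the choice of k and w is irrelevant.
  · have hj : hC.ofFreeRack ⟨k, w⟩ = j := by
      rw [RackEnum.Table.Complete.ofFreeRack, hC.act_eq_iff, hC.genLive_eq hk]
      exact hw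
    have hinv : w⁻¹ * (FreeGroup.of k)⁻¹ * w =
        (RackEnum.FreeRack.operator ⟨k, w⟩)⁻¹ := by
      simp only [RackEnum.FreeRack.operator]
      group
    rw [hinv, show w⁻¹ * FreeGroup.of k * w = RackEnum.FreeRack.operator ⟨k, w⟩ from rfl,
      ← hC.act_eq_iff, ← hC.act_eq_iff]
    constructor
    · apply e.injective
      refine (hC.τΩ_act i ⟨k, w⟩).trans ?_
      rw [hj]
      exact (e.apply_symm_apply _).symm
    · apply e.injective
      refine (hC.τΩ_act_inv i ⟨k, w⟩).trans ?_
      rw [hj]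
      exact (e.apply_symm_apply _).symm
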